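/- **Setting.** Let $\tau$ be a finite relational signature (finitely many relation symbols, of arbitrary finite arities, and no function or constant symbols), and let $R$ be a new relation symbol of arbitrary finite arity. Structures are arbitrary (finite or infinite) nonempty structures. For a $\tau$-structure $A$, the Gaifman graph $G_A$ joins distinct points $a,b\in A$ iff they occur together in some tuple of some relation of $A$; $B^{G_A}(a,r)$ is the ball of radius $r$ around $a$ in $G_A$, and $A(a,r)$ is the substructure of $A$ induced on this ball, with $a$ as distinguished point. $A$ has degree bounded by $d$ (finite degree) if every vertex of $G_A$ has at most $d$ (finitely many) neighbors. *Hanf locality.* For $r,t\in\mathbb N$, structures $A,B$ are *Hanf threshold $(r,t)$-equivalent* if for every pointed $\tau$-structure $C$ the sets $\{a\in A: A(a,r)\cong C\}$ and $\{b\in B: B(b,r)\cong C\}$ either have the same cardinality or both have at least $t$ elements. A class $\mathfrak J$ of $\tau$-structures is *Hanf $(r,t)$-threshold local on* a class $\mathfrak K$ if any two $(r,t)$-equivalent structures $A,B\in\mathfrak K$ satisfy $A\in\mathfrak J\iff B\in\mathfrak J$. *Presentations.* An *$R$-presentation* of $A$ is an expansion of $A$ to a $\tau\cup\{R\}$-structure.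 An *$R$-presentation scheme* $\mathbb P$ for a class $\mathfrak K$ of $\tau$-structures is a collection of $R$-presentations of members of $\mathfrak K$ containing at least one presentation of each member of $\mathfrak K$; $A^*\mathbb P A$ means that $A^*\in\mathbb P$ is a presentation of $A$. The scheme $\mathbb P$ is - *elementary* if there is a first-order sentence $\theta$ such that for all $A\in\mathfrak K$ and all $R$-presentations $A^*$ of $A$: $A^*\in\mathbb P\iff A^*\models\theta$; - *neighborhood-bounded* if there is $\nu\in\mathbb N$ such that for every $A\in\mathfrak K$ of finite degree, every $A^*\mathbb P A$ and every $a\in A$, $B^{G_{A^*}}(a,1)\subseteq B^{G_A}(a,\nu)$; - *local* (for $\mathfrak K$ closed under substructures) if (i) whenever $A\in\mathfrak K$, $A^*\mathbb P A$ and $B$ is a finite substructure of $A$, then $A^*{\restriction}B\;\mathbb P\;B$; and (ii) whenever $A\in\mathfrak K$, $B,C$ are finite substructures of $A$ with $B\cap C=\emptyset$, $B^*\mathbb P B$ and $C^*\mathbb P C$, there is $A^*\mathbb P A$ with $A^*{\restriction}B=B^*$ and $A^*{\restriction}C=C^*$. A class $\mathfrak J$ of $\tau$-structures is a *$\mathbb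 P$-invariant elementary boolean query on $\mathfrak K$* if there is a first-order sentence $\theta$ of signature $\tau\cup\{R\}$ such that for every $A\in\mathfrak K$: some $A^*\mathbb P A$ satisfies $\theta$ iff every $A^*\mathbb P A$ satisfies $\theta$; and $A\in\mathfrak J$ iff some $A^*\mathbb P A$ satisfies $\theta$. **Theorem.** Let $\mathfrak K$ be a class of $\tau$-structures closed under substructures, let $\mathbb P$ be a local, neighborhood-bounded, elementary $R$-presentation scheme for $\mathfrak K$, and let $\mathfrak J$ be a $\mathbb P$-invariant elementary boolean query on $\mathfrak K$. Then for every $d\in\mathbb N$ there are $r,t\in\mathbb N$ such that $\mathfrak J$ is Hanf $(r,t)$-threshold local on the class of all structures in $\mathfrak K$ of degree bounded by $d$. -/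

import Mathlib

universe u v w

namespace HanfLocality

open FirstOrder FirstOrder.Language

/-- Structures of similarity type `L` with universe in `Type w`. -/
abbrev Str (L : FirstOrder.Language.{u, v}) := CategoryTheory.Bundled.{w} L.Structure

/-- The similarity type with a single relation symbol `R`, of arity `k`. -/
inductive RelSymbol (k : ℕ) : ℕ → Type
  | R : RelSymbol k k

/-- The similarity type `{R}`, where `R` is a `k`-ary relation symbol. -/
def singleRel (k : ℕ) : FirstOrder.Language.{0, 0} := ⟨fun _ => Empty, RelSymbol k⟩

/-- The `{R}`-structure on `M` in which `R` is interpreted by `ρ`. -/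
@[reducible] def singleRelStructure {k : ℕ} {M : Type w} (ρ : (Fin k → M) → Prop) :
    (singleRel k).Structure M where
  funMap := fun f _ => nomatch f
  RelMap := fun r => match r with
    | RelSymbol.R => ρ

/-- The similarity type `L ∪ {R}`, where `R` is a new `k`-ary relation symbol. -/
abbrev withRel (L : FirstOrder.Language.{u, v}) (k : ℕ) : FirstOrder.Language.{u, v} := L.sum (singleRel k)

/-- The expansion of the `L`-structure `A` to an `L ∪ {R}`-structure in which `R` is interpreted
by `ρ`. Every `R`-presentation of `A` is of this form, for exactly one `ρ`. -/
abbrev expand {L : FirstOrder.Language.{u, v}} (A : Str.{u, v, w} L) {k : ℕ} (ρ : (Fin k → A) → Prop) :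
    Str.{u, v, w} (withRel L k) :=
  ⟨A, letI := singleRelStructure ρ; inferInstanceAs ((L.sum (singleRel k)).Structure A)⟩

/-- The Gaifman graph of `A`. -/
def gaifmanGraph {L : FirstOrder.Language.{u, v}} (A : Str.{u, v, w} L) : SimpleGraph A where
  Adj a b := a ≠ b ∧ ∃ (n : ℕ) (r : L.Relations n) (c : Fin n → A),
    Structure.RelMap r c ∧ ∃ i j, c i = a ∧ c j = b
  symm := ⟨fun _ _ ⟨h, n, r, c, hc, i, j, hi, hj⟩ => ⟨h.symm, n, r, c, hc, j, i, hj, hi⟩⟩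
  loopless := ⟨fun _ h => h.1 rfl⟩

/-- The ball of radius `r` around `a` in the Gaifman graph of `A` (the extended distance is
infinite between points of different components). -/
def ball {L : FirstOrder.Language.{u, v}} (A : Str.{u, v, w} L) (a : A) (r : ℕ) : Set A :=
  {c | (gaifmanGraph A).edist a c ≤ r}

/-- `A` has degree bounded by `d`. -/
def DegreeBounded {L : FirstOrder.Language.{u, v}} (d : ℕ) (A : Str.{u, v, w} L) : Prop :=
  ∀ a : A, ((gaifmanGraph A).neighborSet a).encard ≤ d

/-- `A` has finite degree, that is, `A` is locally finite. -/
def FiniteDegree {L : FirstOrder.Language.{u, v}} (A : Str.{u, v, w} L) : Prop :=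
  ∀ a : A, ((gaifmanGraph A).neighborSet a).Finite

section Relational

variable {L : FirstOrder.Language.{u, v}} [L.IsRelational]

/-- The substructure of `A` induced on the ball of radius `r` around `a`. -/
def nbhd (A : Str.{u, v, w} L) (a : A) (r : ℕ) : L.Substructure A where
  carrier := ball A a r
  fun_mem := fun f => isEmptyElim f

theorem self_mem_nbhd (A : Str.{u, v, w} L) (a : A) (r : ℕ) : a ∈ nbhd A a r := by
  change (gaifmanGraph A).edist a a ≤ r
  simp

/-- The pointed `r`-neighborhood of `a` in `A` is isomorphic to the pointed structure `(C, c)`. -/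
def NbhdIso (A : Str.{u, v, w} L) (a : A) (r : ℕ) (C : Str.{u, v, w} L) (c : C) : Prop :=
  ∃ f : (nbhd A a r) ≃[L] C, f ⟨a, self_mem_nbhd A a r⟩ = c

/-- The sets `X` and `Y` are equipollent up to threshold `t`. -/
def EquipollentUpTo {α β : Type w} (t : ℕ) (X : Set α) (Y : Set β) : Prop :=
  Cardinal.mk X = Cardinal.mk Y ∨ ((t : Cardinal) ≤ Cardinal.mk X ∧ (t : Cardinal) ≤ Cardinal.mk Y)

/-- `A` and `B` are Hanf threshold `(r, t)`-equivalent. -/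
def HanfEquiv (r t : ℕ) (A B : Str.{u, v, w} L) : Prop :=
  ∀ (C : Str.{u, v, w} L) (c : C),
    EquipollentUpTo t {a : A | NbhdIso A a r C c} {b : B | NbhdIso B b r C c}

/-- `J` is Hanf `(r, t)`-threshold local on `K`. -/
def HanfThresholdLocal (r t : ℕ) (J K : Set (Str.{u, v, w} L)) : Prop :=
  ∀ A ∈ K, ∀ B ∈ K, HanfEquiv r t A B → (A ∈ J ↔ B ∈ J)

end Relational

variable {L : FirstOrder.Language.{u, v}}

/-- A substructure of `A`, with the induced structure, as a structure in its own right. -/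
abbrev subStr {A : Str.{u, v, w} L} (B : L.Substructure A) : Str.{u, v, w} L := ⟨B, inferInstance⟩

/-- `K` is closed under (nonempty) substructures. -/
def SubstructureClosed (K : Set (Str.{u, v, w} L)) : Prop :=
  ∀ A ∈ K, ∀ B : L.Substructure A, (B : Set A).Nonempty → subStr B ∈ K

/-- An `R`-presentation scheme for `K`, `R` being `k`-ary: a collection of `R`-presentations of
members of `K` which contains at least one presentation of each member of `K`.
`P.Pres A ρ` says that the expansion of `A` by `ρ` belongs to the collection. -/
structure PresentationScheme (K : Set (Str.{u, v, w} L)) (k : ℕ) where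
  Pres : ∀ A : Str.{u, v, w} L, ((Fin k → A) → Prop) → Prop
  mem_of_pres : ∀ A ρ, Pres A ρ → A ∈ K
  exists_pres : ∀ A ∈ K, ∃ ρ, Pres A ρ

/-- The restriction of a relation on `A` to a substructure `B` of `A`. -/
def restrictRel {A : Str.{u, v, w} L} {k : ℕ} (ρ : (Fin k → A) → Prop) (B : L.Substructure A) :
    (Fin k → B) → Prop :=
  fun x => ρ (fun i => (x i : A))

namespace PresentationScheme

variable {K : Set (Str.{u, v, w} L)} {k : ℕ} (P : PresentationScheme K k)

/-- Membership in `P` is defined by a first-order sentence. -/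
def IsElementary : Prop :=
  ∃ θ : (withRel L k).Sentence, ∀ A ∈ K, ∀ ρ : (Fin k → A) → Prop,
    P.Pres A ρ ↔ expand A ρ ⊨ θ

/-- There is a neighborhood expansion factor `ν` for `P`. -/
def IsNeighborhoodBounded : Prop :=
  ∃ ν : ℕ, ∀ A ∈ K, FiniteDegree A → ∀ ρ : (Fin k → A) → Prop, P.Pres A ρ →
    ∀ a : A, ball (expand A ρ) a 1 ⊆ ball A a ν

/-- Localization: the restriction of a presentation of a structure to a finite substructure is a
presentation of that substructure. -/
def HasLocalization : Prop :=
  ∀ A ∈ K, ∀ ρ : (Fin k → A) → Prop, P.Pres A ρ →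
    ∀ B : L.Substructure A, (B : Set A).Finite → (B : Set A).Nonempty →
      P.Pres (subStr B) (restrictRel ρ B)

/-- Disjoint local amalgamation: presentations of two disjoint finite substructures of a structure
extend to a presentation of the structure. -/
def HasDisjointLocalAmalgamation : Prop :=
  ∀ A ∈ K, ∀ B C : L.Substructure A, (B : Set A).Finite → (B : Set A).Nonempty →
    (C : Set A).Finite → (C : Set A).Nonempty → Disjoint (B : Set A) (C : Set A) →
    ∀ ρB ρC, P.Pres (subStr B) ρB → P.Pres (subStr C) ρC →
      ∃ ρ : (Fin k → A) → Prop, P.Pres A ρ ∧ restrictRel ρ B = ρB ∧ restrictRel ρ C = ρC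

/-- `P` is local. -/
def IsLocal : Prop := P.HasLocalization ∧ P.HasDisjointLocalAmalgamation

/-- The sentence `θ` is `P`-invariant over `K`. -/
def InvariantSentence (θ : (withRel L k).Sentence) : Prop :=
  ∀ A ∈ K, (∃ ρ : (Fin k → A) → Prop, P.Pres A ρ ∧ expand A ρ ⊨ θ) ↔
    ∀ ρ : (Fin k → A) → Prop, P.Pres A ρ → expand A ρ ⊨ θ

/-- `J` is a `P`-invariant elementary boolean query on `K`. -/
def InvariantElementary (J : Set (Str.{u, v, w} L)) : Prop :=
  ∃ θ : (withRel L k).Sentence, P.InvariantSentence θ ∧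
    ∀ A ∈ K, A ∈ J ↔ ∃ ρ : (Fin k → A) → Prop, P.Pres A ρ ∧ expand A ρ ⊨ θ

end PresentationScheme

end HanfLocality

/-! By invariance, one presentation of each structure decides the query, so it suffices to find
presentations `ρ` of `A` and `σ` of `B` whose expansions agree on the defining sentence.
Neighborhood-boundedness with factor `ν` keeps the degree of an expansion at most `(d+1)^ν`. Hanf's
theorem in bounded degree (`exists_realize_sentence_iff_of_hanfEq`) therefore reduces everything to
`exists_hanfEq_expand`: sufficiently Hanf equivalent `A` and `B` have presentations whose expansions
are Hanf `(r,t)`-equivalent.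

Put `R = ν * r`, so that `r`-balls of an expansion lie in `R`-balls of the structure. In bounded
degree there are finitely many `R`-types, so `exists_gap` gives an `s` such that each type is
realized either fewer than `s` times (rare) or at least `g s` times, for a prescribed fast-growing
`g`. Rare points are few. For each frequent type and each of the finitely many presentations of its
neighborhood, there is room for `t` realizations far from one another and from the rare points;
disjoint local amalgamation then builds a `ρ` that shows the given presentation at all of them
(`exists_pres_realizing`). The set `X` of rare points and chosen realizations has bounded size, so
the back-and-forth argument gives an isomorphism `F` from the `R`-ball around `X` onto the `R`-ball
around `F '' X` in `B`. Transport `ρ` along `F` and extend the result to a presentation `σ` of `B`.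

The expansions are Hanf equivalent (`hanfEq_expand`): an `r`-type realized only at rare points on
both sides is counted exactly by `F`, while any other comes from a presented frequent neighborhood,
hence occurs at least `t` times in `X` and in `F '' X`. -/

namespace HanfLocality

open FirstOrder FirstOrder.Language Set

/-! ### Balls in Gaifman graphs and their sizes in bounded degree. -/

section Balls

variable {L : FirstOrder.Language.{u, v}} {A B C : Str.{u, v, w} L}

theorem mem_ball_self (a : A) (r : ℕ) : a ∈ ball A a r := by
  change (gaifmanGraph A).edist a a ≤ r
  simp

theorem ball_mono {a : A} {r s : ℕ} (h : r ≤ s) : ball A a r ⊆ ball A a s :=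
  fun _ hx => le_trans (show (gaifmanGraph A).edist a _ ≤ r from hx) (by exact_mod_cast h)

theorem mem_ball_comm {a b : A} {r : ℕ} : b ∈ ball A a r ↔ a ∈ ball A b r := by
  change (gaifmanGraph A).edist a b ≤ r ↔ (gaifmanGraph A).edist b a ≤ r
  rw [SimpleGraph.edist_comm]

theorem mem_ball_trans {a b c : A} {r s : ℕ} (h : b ∈ ball A a r) (h' : c ∈ ball A b s) :
    c ∈ ball A a (r + s) := by
  change (gaifmanGraph A).edist a c ≤ ((r + s : ℕ) : ℕ∞)
  push_cast
  exact (gaifmanGraph A).edist_triangle.trans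
    (add_le_add (show (gaifmanGraph A).edist a b ≤ r from h) h')

theorem mem_ball_one {a b : A} : b ∈ ball A a 1 ↔ b = a ∨ (gaifmanGraph A).Adj a b := by
  change (gaifmanGraph A).edist a b ≤ ((1 : ℕ) : ℕ∞) ↔ _
  rw [Nat.cast_one, SimpleGraph.edist_le_one_iff_adj_or_eq, or_comm, eq_comm]

theorem mem_ball_zero {a b : A} : b ∈ ball A a 0 ↔ b = a := by
  change (gaifmanGraph A).edist a b ≤ ((0 : ℕ) : ℕ∞) ↔ _
  rw [Nat.cast_zero, nonpos_iff_eq_zero, SimpleGraph.edist_eq_zero_iff, eq_comm]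

theorem exists_mem_ball_of_succ {a b : A} {r : ℕ} (h : b ∈ ball A a (r + 1)) :
    ∃ c ∈ ball A a r, b ∈ ball A c 1 := by
  have h1 : (gaifmanGraph A).edist b a ≤ ((r + 1 : ℕ) : ℕ∞) := mem_ball_comm.1 h
  obtain ⟨p, hp⟩ := SimpleGraph.exists_walk_of_edist_ne_top
    (ne_top_of_le_ne_top (ENat.natCast_ne_top _) h1)
  rw [← hp] at h1
  have h2 : p.length ≤ r + 1 := by exact_mod_cast h1
  cases p with
  | nil => exact ⟨a, mem_ball_self a r, mem_ball_self a 1⟩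
  | @cons _ c _ hbc q =>
    refine ⟨c, mem_ball_comm.1 ?_, mem_ball_one.2 (Or.inr hbc.symm)⟩
    refine le_trans (SimpleGraph.edist_le q) ?_
    have : q.length ≤ r := by simpa using h2
    exact_mod_cast this

theorem mem_ball_one_of_relMap {n : ℕ} {r : L.Relations n} {c : Fin n → A}
    (h : Structure.RelMap r c) (i j : Fin n) : c j ∈ ball A (c i) 1 := by
  rw [mem_ball_one]
  by_cases hij : c j = c i
  · exact Or.inl hij
  · exact Or.inr ⟨fun h' => hij h'.symm, n, r, c, h, i, j, rfl, rfl⟩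

/-- The ball of radius `r` around the set `X` in the Gaifman graph of `A`. -/
def ballAround (A : Str.{u, v, w} L) (X : Set A) (r : ℕ) : Set A :=
  {y | ∃ x ∈ X, y ∈ ball A x r}

theorem subset_ballAround (X : Set A) (r : ℕ) : X ⊆ ballAround A X r :=
  fun x hx => ⟨x, hx, mem_ball_self x r⟩

theorem ballAround_singleton (a : A) (r : ℕ) : ballAround A {a} r = ball A a r := by
  ext; simp [ballAround]

theorem ballAround_insert (a : A) (X : Set A) (r : ℕ) :
    ballAround A (insert a X) r = ballAround A X r ∪ ball A a r := by
  ext; simp [ballAround, or_comm]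

theorem ballAround_empty (r : ℕ) : ballAround A ∅ r = ∅ := by
  ext; simp [ballAround]

theorem ballAround_mono {X Y : Set A} (h : X ⊆ Y) {r s : ℕ} (hr : r ≤ s) :
    ballAround A X r ⊆ ballAround A Y s :=
  fun _ ⟨x, hx, hy⟩ => ⟨x, h hx, ball_mono hr hy⟩

theorem ball_subset_ballAround {X : Set A} {a : A} (ha : a ∈ X) (r : ℕ) :
    ball A a r ⊆ ballAround A X r :=
  fun _ hy => ⟨a, ha, hy⟩

theorem mem_ballAround_trans {X : Set A} {a b : A} {r s : ℕ} (h : a ∈ ballAround A X r)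
    (h' : b ∈ ball A a s) : b ∈ ballAround A X (r + s) :=
  let ⟨x, hx, hax⟩ := h
  ⟨x, hx, mem_ball_trans hax h'⟩

theorem encard_biUnion_le {α β : Type*} {S : Set α} {f : α → Set β} {m n : ℕ}
    (hS : S.encard ≤ m) (hf : ∀ x ∈ S, (f x).encard ≤ n) :
    (⋃ x ∈ S, f x).encard ≤ ((m * n : ℕ) : ℕ∞) := by
  classical
  have hfin : S.Finite := Set.finite_of_encard_le_coe hS
  lift S to Finset α using hfin
  have hS' : S.card ≤ m := by
    rw [Set.encard_coe_eq_coe_finsetCard] at hS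
    exact_mod_cast hS
  have key : ∀ T : Finset α, T ⊆ S →
      (⋃ x ∈ (T : Set α), f x).encard ≤ ((T.card * n : ℕ) : ℕ∞) := by
    intro T
    induction T using Finset.induction_on with
    | empty => simp
    | insert a T ha ih =>
      intro hT
      rw [Finset.coe_insert, Set.biUnion_insert, Finset.card_insert_of_notMem ha]
      refine (Set.encard_union_le _ _).trans ?_
      have h1 := hf a (by exact_mod_cast hT (Finset.mem_insert_self a T))
      have h2 := ih ((Finset.subset_insert a T).trans hT)
      refine (add_le_add h1 h2).trans (le_of_eq ?_)
      push_cast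
      ring
  refine (key S subset_rfl).trans ?_
  exact_mod_cast Nat.mul_le_mul_right n hS'

theorem DegreeBounded.encard_ball_le {d : ℕ} (h : DegreeBounded d A) (a : A) (r : ℕ) :
    (ball A a r).encard ≤ (((d + 1) ^ r : ℕ) : ℕ∞) := by
  have one : ∀ b : A, (ball A b 1).encard ≤ ((d + 1 : ℕ) : ℕ∞) := by
    intro b
    have hsub : ball A b 1 ⊆ insert b ((gaifmanGraph A).neighborSet b) := by
      intro c hc
      rcases mem_ball_one.1 hc with rfl | hc
      · exact Set.mem_insert _ _
      · exact Set.mem_insert_of_mem _ hc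
    refine (Set.encard_le_encard hsub).trans ((Set.encard_insert_le _ _).trans ?_)
    push_cast
    exact add_le_add (h b) le_rfl
  induction r with
  | zero =>
    have : ball A a 0 = {a} := by ext; simp [mem_ball_zero]
    simp [this]
  | succ r ih =>
    have hsub : ball A a (r + 1) ⊆ ⋃ x ∈ ball A a r, ball A x 1 := by
      intro b hb
      obtain ⟨c, hc, hbc⟩ := exists_mem_ball_of_succ hb
      exact Set.mem_biUnion hc hbc
    exact (Set.encard_le_encard hsub).trans (encard_biUnion_le ih fun x _ => one x)

theorem DegreeBounded.encard_ballAround_le {d : ℕ} (h : DegreeBounded d A) {X : Set A} {n : ℕ}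
    (hX : X.encard ≤ n) (r : ℕ) :
    (ballAround A X r).encard ≤ ((n * (d + 1) ^ r : ℕ) : ℕ∞) := by
  have : ballAround A X r = ⋃ x ∈ X, ball A x r := by
    ext; simp [ballAround]
  rw [this]
  exact encard_biUnion_le hX fun x _ => h.encard_ball_le x r

theorem DegreeBounded.finiteDegree {d : ℕ} (h : DegreeBounded d A) : FiniteDegree A :=
  fun a => Set.finite_of_encard_le_coe (h a)

end Balls

/-! ### Partial isomorphisms and neighborhood types. -/

section PartialIso

variable {L : FirstOrder.Language.{u, v}} {A B C : Str.{u, v, w} L}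

/-- `f` is an isomorphism between the structures induced on its source and its target. -/
def IsPartialIso {L : FirstOrder.Language.{u, v}} {A B : Str.{u, v, w} L}
    (f : PartialEquiv A B) : Prop :=
  ∀ (n : ℕ) (r : L.Relations n) (c : Fin n → A), (∀ i, c i ∈ f.source) →
    (Structure.RelMap r c ↔ Structure.RelMap r (f ∘ c))

theorem IsPartialIso.symm {f : PartialEquiv A B} (hf : IsPartialIso f) : IsPartialIso f.symm := by
  intro n r c hc
  have h := hf n r (f.symm ∘ c) fun i => f.map_target (hc i)
  have h' : f ∘ f.symm ∘ c = c := funext fun i => f.right_inv (hc i)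
  rw [h'] at h
  exact h.symm

theorem IsPartialIso.trans {f : PartialEquiv A B} {g : PartialEquiv B C} (hf : IsPartialIso f)
    (hg : IsPartialIso g) : IsPartialIso (f.trans g) := by
  intro n r c hc
  have hc' : ∀ i, c i ∈ f.source ∧ f (c i) ∈ g.source := fun i => by simpa using hc i
  rw [hf n r c fun i => (hc' i).1, hg n r (f ∘ c) fun i => (hc' i).2]
  rfl

theorem IsPartialIso.restr {f : PartialEquiv A B} (hf : IsPartialIso f) (S : Set A) :
    IsPartialIso (f.restr S) :=
  fun n r c hc => hf n r c fun i => (hc i).1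

theorem isPartialIso_ofSet (S : Set A) : IsPartialIso (PartialEquiv.ofSet S) :=
  fun _ _ _ _ => Iff.rfl

/-- All entries of a tuple witnessing an edge of a short path from `X` stay inside the ball, so `f`
preserves every such edge. Nothing is asked of the target. -/
theorem IsPartialIso.map_ballAround {f : PartialEquiv A B} (hf : IsPartialIso f) {X : Set A}
    {r s : ℕ} (hX : ballAround A X r ⊆ f.source) (hs : s ≤ r) {y : A}
    (hy : y ∈ ballAround A X s) : f y ∈ ballAround B (f '' X) s := by
  obtain ⟨x, hx, hxy⟩ := hy
  refine ⟨f x, ⟨x, hx, rfl⟩, ?_⟩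
  induction s generalizing y with
  | zero => rw [mem_ball_zero.1 hxy]; exact mem_ball_self _ _
  | succ s ih =>
    obtain ⟨z, hz, hzy⟩ := exists_mem_ball_of_succ hxy
    refine mem_ball_trans (ih (Nat.le_of_succ_le hs) hz) ?_
    rcases mem_ball_one.1 hzy with rfl | ⟨_, n, q, c, hc, i, j, rfl, rfl⟩
    · exact mem_ball_self _ _
    · have hsrc : ∀ l, c l ∈ f.source := fun l =>
        hX ⟨x, hx, ball_mono hs (mem_ball_trans hz (mem_ball_one_of_relMap hc i l))⟩
      exact mem_ball_one_of_relMap ((hf n q c hsrc).1 hc) i j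

theorem IsPartialIso.image_ballAround {f : PartialEquiv A B} (hf : IsPartialIso f) {X : Set A}
    {s : ℕ} (hX : ballAround A X s ⊆ f.source) (hY : ballAround B (f '' X) s ⊆ f.target) :
    f '' ballAround A X s = ballAround B (f '' X) s := by
  have hXs : X ⊆ f.source := (subset_ballAround X s).trans hX
  have himg : f.symm '' (f '' X) = X := by
    ext x
    constructor
    · rintro ⟨_, ⟨x', hx', rfl⟩, rfl⟩
      rwa [f.left_inv (hXs hx')]
    · intro hx
      exact ⟨f x, ⟨x, hx, rfl⟩, f.left_inv (hXs hx)⟩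
  apply Set.Subset.antisymm
  · rintro _ ⟨y, hy, rfl⟩
    exact hf.map_ballAround hX le_rfl hy
  · intro z hz
    refine ⟨f.symm z, ?_, f.right_inv (hY hz)⟩
    have := hf.symm.map_ballAround (X := f '' X) (r := s) hY le_rfl hz
    rwa [himg] at this

theorem partialEquiv_restr_target {α β : Type*} (f : PartialEquiv α β) {S : Set α}
    (hS : S ⊆ f.source) : (f.restr S).target = f '' S := by
  rw [← PartialEquiv.image_source_eq_target, PartialEquiv.restr_source,
    Set.inter_eq_self_of_subset_right hS]
  rfl

/-- There is an isomorphism between the structures induced on `S` and `T` which maps `a` to `b`. -/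
def LocalIso (A : Str.{u, v, w} L) (S : Set A) (a : A) (B : Str.{u, v, w} L) (T : Set B)
    (b : B) : Prop :=
  ∃ f : PartialEquiv A B, IsPartialIso f ∧ f.source = S ∧ f.target = T ∧ a ∈ S ∧ f a = b

theorem LocalIso.refl {S : Set A} {a : A} (ha : a ∈ S) : LocalIso A S a A S a :=
  ⟨PartialEquiv.ofSet S, isPartialIso_ofSet S, rfl, rfl, ha, rfl⟩

theorem LocalIso.symm {S : Set A} {a : A} {T : Set B} {b : B} (h : LocalIso A S a B T b) :
    LocalIso B T b A S a := by
  obtain ⟨f, hf, rfl, rfl, ha, rfl⟩ := h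
  exact ⟨f.symm, hf.symm, rfl, rfl, f.map_source ha, f.left_inv ha⟩

theorem LocalIso.trans {S : Set A} {a : A} {T : Set B} {b : B} {U : Set C} {c : C}
    (h : LocalIso A S a B T b) (h' : LocalIso B T b C U c) : LocalIso A S a C U c := by
  obtain ⟨f, hf, rfl, hT, ha, rfl⟩ := h
  obtain ⟨g, hg, rfl, rfl, hb, rfl⟩ := h'
  refine ⟨f.trans g, hf.trans hg, ?_, ?_, ha, rfl⟩
  · rw [PartialEquiv.trans_source, ← hT]
    exact Set.inter_eq_self_of_subset_left fun x hx => f.map_source hx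
  · rw [PartialEquiv.trans_target, hT]
    exact Set.inter_eq_self_of_subset_left fun x hx => g.map_target hx

/-- A partial isomorphism restricts to an isomorphism of balls around a set. -/
theorem IsPartialIso.exists_restr_ballAround {f : PartialEquiv A B} (hf : IsPartialIso f)
    {X : Set A} {s : ℕ} (hX : ballAround A X s ⊆ f.source)
    (hY : ballAround B (f '' X) s ⊆ f.target) :
    IsPartialIso (f.restr (ballAround A X s)) ∧
      (f.restr (ballAround A X s)).source = ballAround A X s ∧
      (f.restr (ballAround A X s)).target = ballAround B (f '' X) s := by
  refine ⟨hf.restr _, ?_, ?_⟩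
  · rw [PartialEquiv.restr_source, Set.inter_eq_self_of_subset_right hX]
  · rw [partialEquiv_restr_target f hX, hf.image_ballAround hX hY]

theorem IsPartialIso.localIso_ball {f : PartialEquiv A B} (hf : IsPartialIso f) {a : A} {s : ℕ}
    (hX : ball A a s ⊆ f.source) (hY : ball B (f a) s ⊆ f.target) :
    LocalIso A (ball A a s) a B (ball B (f a) s) (f a) := by
  rw [← ballAround_singleton] at hX hY ⊢
  rw [← ballAround_singleton, ← Set.image_singleton] at *
  obtain ⟨h1, h2, h3⟩ := hf.exists_restr_ballAround hX hY
  exact ⟨_, h1, h2, h3, subset_ballAround _ _ rfl, rfl⟩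

/-- The balls of radius `r` around `a` and `b` are isomorphic as pointed structures. -/
def SameType (r : ℕ) (A : Str.{u, v, w} L) (a : A) (B : Str.{u, v, w} L) (b : B) : Prop :=
  LocalIso A (ball A a r) a B (ball B b r) b

theorem SameType.refl (r : ℕ) (a : A) : SameType r A a A a := LocalIso.refl (mem_ball_self a r)

theorem SameType.symm {r : ℕ} {a : A} {b : B} (h : SameType r A a B b) : SameType r B b A a :=
  LocalIso.symm h

theorem SameType.trans {r : ℕ} {a : A} {b : B} {c : C} (h : SameType r A a B b)
    (h' : SameType r B b C c) : SameType r A a C c :=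
  LocalIso.trans h h'

theorem SameType.mono {r s : ℕ} {a : A} {b : B} (h : SameType r A a B b) (hs : s ≤ r) :
    SameType s A a B b := by
  obtain ⟨f, hf, hS, hT, ha, rfl⟩ := h
  exact hf.localIso_ball ((ball_mono hs).trans hS.ge) ((ball_mono hs).trans hT.ge)

end PartialIso

/-! ### Hanf equivalence and its monotonicity. -/

section HanfEq

variable {L : FirstOrder.Language.{u, v}} {A B C : Str.{u, v, w} L}

/-- `A` and `B` realize each pointed `r`-neighborhood equally often, up to threshold `t`. -/
def HanfEq (r t : ℕ) (A B : Str.{u, v, w} L) : Prop :=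
  ∀ (C : Str.{u, v, w} L) (c : C),
    EquipollentUpTo t {a : A | SameType r C c A a} {b : B | SameType r C c B b}

/-- Bridge from isomorphisms onto a whole pointed structure to partial isomorphisms between balls:
the test structure is the ball of `c`. The values chosen outside the balls are irrelevant. -/
theorem nbhdIso_subStr_iff [L.IsRelational] {r : ℕ} {a : A} {c : C} :
    NbhdIso A a r (subStr (nbhd C c r)) ⟨c, self_mem_nbhd C c r⟩ ↔ SameType r C c A a := by
  classical
  constructor
  · rintro ⟨f, hf⟩
    refine LocalIso.symm ⟨⟨fun x => if h : x ∈ nbhd A a r then (f ⟨x, h⟩).1 else c,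
      fun y => if h : y ∈ nbhd C c r then (f.symm ⟨y, h⟩).1 else a, ball A a r, ball C c r,
      ?_, ?_, ?_, ?_⟩, ?_, rfl, rfl, mem_ball_self a r, ?_⟩
    · intro x hx
      rw [dif_pos (show x ∈ nbhd A a r from hx)]
      exact (f ⟨x, hx⟩).2
    · intro y hy
      rw [dif_pos (show y ∈ nbhd C c r from hy)]
      exact (f.symm ⟨y, hy⟩).2
    · intro x hx
      simp only [dif_pos (show x ∈ nbhd A a r from hx)]
      rw [dif_pos (f ⟨x, hx⟩).2]
      simp
    · intro y hy
      simp only [dif_pos (show y ∈ nbhd C c r from hy)]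
      rw [dif_pos (f.symm ⟨y, hy⟩).2]
      simp
    · intro n q x hx
      have h := f.map_rel q fun i => ⟨x i, hx i⟩
      refine Iff.trans h.symm ?_
      exact iff_of_eq (congrArg (Structure.RelMap (M := C) q)
        (funext fun i => (dif_pos (c := x i ∈ nbhd A a r) (t := fun h => (f ⟨x i, h⟩).1)
          (e := fun _ => c) (hx i)).symm))
    · change dite _ _ _ = _
      rw [dif_pos (self_mem_nbhd A a r), hf]
  · intro h
    obtain ⟨f, hf, hS, hT, ha, hfa⟩ := h.symm
    refine ⟨⟨⟨fun x => ⟨f x, ?_⟩, fun y => ⟨f.symm y, ?_⟩, ?_, ?_⟩, ?_, ?_⟩, ?_⟩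
    · change f x ∈ ball C c r
      rw [← hT]
      exact f.map_source (hS ▸ x.2)
    · change f.symm y ∈ ball A a r
      rw [← hS]
      exact f.map_target (hT ▸ y.2)
    · intro x
      exact Subtype.ext (f.left_inv (hS ▸ x.2))
    · intro x
      exact Subtype.ext (f.right_inv (hT ▸ x.2))
    · intro n q
      exact isEmptyElim q
    · intro n q x
      exact (hf n q (fun i => (x i).1) fun i => hS ▸ (x i).2).symm
    · exact Subtype.ext hfa

theorem HanfEquiv.hanfEq [L.IsRelational] {r t : ℕ} (h : HanfEquiv r t A B) : HanfEq r t A B := by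
  intro C c
  have := h (subStr (nbhd C c r)) ⟨c, self_mem_nbhd C c r⟩
  simpa only [nbhdIso_subStr_iff] using this

theorem EquipollentUpTo.symm {α β : Type w} {t : ℕ} {X : Set α} {Y : Set β}
    (h : EquipollentUpTo t X Y) : EquipollentUpTo t Y X :=
  h.imp Eq.symm And.symm

theorem HanfEq.symm {r t : ℕ} (h : HanfEq r t A B) : HanfEq r t B A :=
  fun C c => (h C c).symm

theorem EquipollentUpTo.encard {α β : Type w} {t : ℕ} {X : Set α} {Y : Set β}
    (h : EquipollentUpTo t X Y) :
    X.encard = Y.encard ∨ ((t : ℕ∞) ≤ X.encard ∧ (t : ℕ∞) ≤ Y.encard) := by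
  rw [← Set.toENat_cardinalMk, ← Set.toENat_cardinalMk]
  refine h.imp (fun h => by rw [h]) (fun h => ?_)
  rwa [Cardinal.natCast_le_toENat, Cardinal.natCast_le_toENat]

theorem equipollentUpTo_of_encard_le {α β : Type w} {t : ℕ} {X : Set α} {Y : Set β}
    (hX : (t : ℕ∞) ≤ X.encard) (hY : (t : ℕ∞) ≤ Y.encard) : EquipollentUpTo t X Y := by
  rw [← Set.toENat_cardinalMk, Cardinal.natCast_le_toENat] at hX hY
  exact Or.inr ⟨hX, hY⟩

theorem EquipollentUpTo.mono {α β : Type w} {s t : ℕ} {X : Set α} {Y : Set β}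
    (h : EquipollentUpTo t X Y) (hs : s ≤ t) : EquipollentUpTo s X Y := by
  have hs' : (s : Cardinal) ≤ t := by exact_mod_cast hs
  exact h.imp id fun h => ⟨hs'.trans h.1, hs'.trans h.2⟩

theorem HanfEq.mono_threshold {r s t : ℕ} (h : HanfEq r t A B) (hs : s ≤ t) : HanfEq r s A B :=
  fun C c => (h C c).mono hs

theorem nonempty_equiv_of_fiber_equiv {α β γ : Type*} (p : α → γ) (q : β → γ)
    (h : ∀ c, Nonempty ({a // p a = c} ≃ {b // q b = c})) : Nonempty (α ≃ β) :=
  ⟨(Equiv.sigmaFiberEquiv p).symm.trans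
    ((Equiv.sigmaCongrRight fun c => (h c).some).trans (Equiv.sigmaFiberEquiv q))⟩

theorem HanfEq.mono_radius {r s t : ℕ} (h : HanfEq r t A B) (hs : s ≤ r) : HanfEq s t A B := by
  intro C c
  -- either some `r`-type refining the `s`-type is frequent, or all of them match exactly
  have big : ∀ (D : Str.{u, v, w} L) (x : D), SameType s C c D x →
      (t : Cardinal) ≤ Cardinal.mk {a : A | SameType r D x A a} →
      (t : Cardinal) ≤ Cardinal.mk {b : B | SameType r D x B b} →
      EquipollentUpTo t {a : A | SameType s C c A a} {b : B | SameType s C c B b} := by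
    intro D x hx h1 h2
    refine Or.inr ⟨h1.trans (Cardinal.mk_le_mk_of_subset ?_),
      h2.trans (Cardinal.mk_le_mk_of_subset ?_)⟩
    · intro a ha; exact hx.trans (SameType.mono ha hs)
    · intro a ha; exact hx.trans (SameType.mono ha hs)
  by_contra hcon
  have eq : ∀ (D : Str.{u, v, w} L) (x : D), SameType s C c D x →
      Cardinal.mk {a : A | SameType r D x A a} = Cardinal.mk {b : B | SameType r D x B b} := by
    intro D x hx
    rcases h D x with h' | ⟨h1, h2⟩
    · exact h'
    · exact absurd (big D x hx h1 h2) hcon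
  -- The label of a point stands for its `r`-type, encoded by the realizations of that type in `A`
  -- and in `B`. Matching the fibers of the labels gives a bijection of the `s`-types.
  let p : {a : A | SameType s C c A a} → Set A × Set B := fun x =>
    ({a | SameType r A x.1 A a}, {b | SameType r A x.1 B b})
  let q : {b : B | SameType s C c B b} → Set A × Set B := fun x =>
    ({a | SameType r B x.1 A a}, {b | SameType r B x.1 B b})
  have cls : ∀ (D E : Str.{u, v, w} L) (x : D) (y : E), SameType r D x E y →
      (({a | SameType r E y A a}, {b | SameType r E y B b}) : Set A × Set B) =
      ({a | SameType r D x A a}, {b | SameType r D x B b}) := by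
    intro D E x y hxy
    ext z
    · exact ⟨hxy.trans, hxy.symm.trans⟩
    · exact ⟨hxy.trans, hxy.symm.trans⟩
  have fib : ∀ (D : Str.{u, v, w} L) (x : D), SameType s C c D x →
      Nonempty ({a // p a = ({a | SameType r D x A a}, {b | SameType r D x B b})} ≃
        {b // q b = ({a | SameType r D x A a}, {b | SameType r D x B b})}) := by
    intro D x hx
    obtain ⟨e⟩ := Cardinal.eq.1 (eq D x hx)
    refine ⟨(Equiv.trans ?_ e).trans ?_⟩
    · exact
        { toFun := fun a => ⟨a.1.1, by
            have h : a.1.1 ∈ (p a.1).1 := SameType.refl r a.1.1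
            rwa [a.2] at h⟩
          invFun := fun a => ⟨⟨a.1, hx.trans (SameType.mono a.2 hs)⟩, cls _ _ _ _ a.2⟩
          left_inv := fun a => rfl
          right_inv := fun a => rfl }
    · exact
        { invFun := fun a => ⟨a.1.1, by
            have h : a.1.1 ∈ (q a.1).2 := SameType.refl r a.1.1
            rwa [a.2] at h⟩
          toFun := fun a => ⟨⟨a.1, hx.trans (SameType.mono a.2 hs)⟩, cls _ _ _ _ a.2⟩
          left_inv := fun a => rfl
          right_inv := fun a => rfl }
  refine hcon (Or.inl (Cardinal.eq.2 (nonempty_equiv_of_fiber_equiv p q fun z => ?_)))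
  by_cases hz : (∃ a, p a = z) ∨ ∃ b, q b = z
  · rcases hz with ⟨a, rfl⟩ | ⟨b, rfl⟩
    · exact fib A a.1 a.2
    · exact fib B b.1 b.2
  · push Not at hz
    have : IsEmpty {a // p a = z} := ⟨fun a => hz.1 a.1 a.2⟩
    have : IsEmpty {b // q b = z} := ⟨fun a => hz.2 a.1 a.2⟩
    exact ⟨Equiv.equivOfIsEmpty _ _⟩

end HanfEq

/-! ### The extension step for partial isomorphisms of balls. -/

section BackAndForth

variable {L : FirstOrder.Language.{u, v}} {A B C : Str.{u, v, w} L}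

/-- A tuple meeting both `s`-balls would give a path of length `s + 1 + s` from `X` to `a`. Beyond
this distance the union of the balls carries no mixed tuples. -/
theorem not_relMap_across {X : Set A} {a : A} {s n : ℕ} (ha : a ∉ ballAround A X (2 * s + 1))
    {q : L.Relations n} {c : Fin n → A} (hc : Structure.RelMap q c) {i j : Fin n}
    (hi : c i ∈ ballAround A X s) (hj : c j ∈ ball A a s) : False := by
  refine ha ?_
  have := mem_ballAround_trans (mem_ballAround_trans hi (mem_ball_one_of_relMap hc i j))
    (mem_ball_comm.1 hj)
  rwa [show s + 1 + s = 2 * s + 1 by ring] at this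

theorem disjoint_ballAround_ball {X : Set A} {a : A} {s : ℕ}
    (ha : a ∉ ballAround A X (2 * s + 1)) : Disjoint (ballAround A X s) (ball A a s) := by
  rw [Set.disjoint_left]
  intro y hy hy'
  refine ha (ballAround_mono subset_rfl (by lia) (mem_ballAround_trans hy (mem_ball_comm.1 hy')))

/-- Partial isomorphisms of far apart balls can be glued. -/
theorem exists_partialIso_union {f g : PartialEquiv A B} (hf : IsPartialIso f)
    (hg : IsPartialIso g) {X : Set A} {Y : Set B} {a : A} {b : B} {s : ℕ}
    (hfs : f.source = ballAround A X s) (hft : f.target = ballAround B Y s)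
    (hgs : g.source = ball A a s) (hgt : g.target = ball B b s)
    (ha : a ∉ ballAround A X (2 * s + 1)) (hb : b ∉ ballAround B Y (2 * s + 1)) :
    ∃ F : PartialEquiv A B, IsPartialIso F ∧ F.source = ballAround A X s ∪ ball A a s ∧
      F.target = ballAround B Y s ∪ ball B b s ∧ (∀ x ∈ f.source, F x = f x) ∧
      ∀ x ∈ g.source, F x = g x := by
  classical
  have hs : Disjoint f.source g.source := by
    rw [hfs, hgs]; exact disjoint_ballAround_ball ha
  have ht : Disjoint f.target g.target := by
    rw [hft, hgt]; exact disjoint_ballAround_ball hb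
  have h1 : ∀ x ∈ f.source, f.disjointUnion g hs ht x = f x := fun x hx => if_pos hx
  have h2 : ∀ x ∈ g.source, f.disjointUnion g hs ht x = g x := fun x hx =>
    if_neg fun hx' => Set.disjoint_left.1 hs hx' hx
  refine ⟨f.disjointUnion g hs ht, ?_, by rw [← hfs, ← hgs]; rfl, by rw [← hft, ← hgt]; rfl,
    h1, h2⟩
  intro n q c hc
  by_cases hcf : ∀ i, c i ∈ f.source
  · rw [hf n q c hcf, show f ∘ c = f.disjointUnion g hs ht ∘ c from
      funext fun i => (h1 _ (hcf i)).symm]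
  by_cases hcg : ∀ i, c i ∈ g.source
  · rw [hg n q c hcg, show g ∘ c = f.disjointUnion g hs ht ∘ c from
      funext fun i => (h2 _ (hcg i)).symm]
  push Not at hcf hcg
  obtain ⟨j, hj⟩ := hcf
  obtain ⟨i, hi⟩ := hcg
  have hj' : c j ∈ g.source := (hc j).resolve_left hj
  have hi' : c i ∈ f.source := (hc i).resolve_right hi
  refine iff_of_false (fun h => ?_) (fun h => ?_)
  · exact not_relMap_across ha h (hfs ▸ hi') (hgs ▸ hj')
  · refine not_relMap_across (i := i) (j := j) hb h ?_ ?_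
    · simp only [Function.comp, h1 _ hi', ← hft]
      exact f.map_source hi'
    · simp only [Function.comp, h2 _ hj', ← hgt]
      exact g.map_source hj'

/-- The forth step of the back-and-forth argument for Hanf's theorem. -/
theorem IsPartialIso.exists_extend {f : PartialEquiv A B} (hf : IsPartialIso f) {X : Set A}
    {s t n d : ℕ} (hfs : f.source = ballAround A X (3 * s + 1))
    (hft : f.target = ballAround B (f '' X) (3 * s + 1)) (hX : X.encard ≤ n)
    (hd : DegreeBounded d A) (ht : n * (d + 1) ^ (2 * s + 1) < t) (hAB : HanfEq s t A B)
    (a : A) :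
    ∃ F : PartialEquiv A B, IsPartialIso F ∧ F.source = ballAround A (insert a X) s ∧
      F.target = ballAround B (F '' insert a X) s ∧ ∀ x ∈ X, F x = f x := by
  -- If `a` is near `X`, its `s`-ball already lies in the source, since `(2s+1) + s = 3s+1`, and `f`
  -- is restricted. Otherwise a far point `b` of the same type is glued on.
  by_cases ha : a ∈ ballAround A X (2 * s + 1)
  · have h1 : ballAround A (insert a X) s ⊆ f.source := by
      rw [hfs, ballAround_insert]
      refine Set.union_subset (ballAround_mono subset_rfl (by lia)) fun y hy => ?_
      have := mem_ballAround_trans ha hy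
      rwa [show 2 * s + 1 + s = 3 * s + 1 by ring] at this
    have hfa : f a ∈ ballAround B (f '' X) (2 * s + 1) :=
      hf.map_ballAround (r := 3 * s + 1) hfs.ge (by lia) ha
    have h2 : ballAround B (f '' insert a X) s ⊆ f.target := by
      rw [hft, Set.image_insert_eq, ballAround_insert]
      refine Set.union_subset (ballAround_mono subset_rfl (by lia)) fun y hy => ?_
      have := mem_ballAround_trans hfa hy
      rwa [show 2 * s + 1 + s = 3 * s + 1 by ring] at this
    obtain ⟨h3, h4, h5⟩ := hf.exists_restr_ballAround h1 h2
    exact ⟨_, h3, h4, h5, fun _ _ => rfl⟩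
  · have hXs : X ⊆ f.source := hfs ▸ subset_ballAround X _
    -- Without such a `b`, all realizations in `B` of the type of `a` come through `f` from
    -- realizations near `X`. Since `a` is one more, `B` has strictly fewer than `A`, and fewer than
    -- `t`, against `hAB`.
    obtain ⟨b, hab, hb⟩ : ∃ b, SameType s A a B b ∧ b ∉ ballAround B (f '' X) (2 * s + 1) := by
      by_contra hcon
      push Not at hcon
      set S : Set A := {x | SameType s A a A x} with hS
      set T : Set B := {x | SameType s A a B x} with hT
      have hPfin : ((S ∩ ballAround A X (2 * s + 1)).encard) ≤
          ((n * (d + 1) ^ (2 * s + 1) : ℕ) : ℕ∞) :=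
        (Set.encard_le_encard Set.inter_subset_right).trans (hd.encard_ballAround_le hX _)
      have hTsub : T ⊆ f '' (S ∩ ballAround A X (2 * s + 1)) := by
        intro y hy
        have hy2 := hcon y hy
        have hsub : ballAround B (f '' X) (2 * s + 1) ⊆ f.target := by
          rw [hft]; exact ballAround_mono subset_rfl (by lia)
        have hsub' : ballAround A X (2 * s + 1) ⊆ f.source := by
          rw [hfs]; exact ballAround_mono subset_rfl (by lia)
        rw [← hf.image_ballAround hsub' hsub] at hy2
        obtain ⟨x, hx, rfl⟩ := hy2
        refine ⟨x, ⟨SameType.trans hy (SameType.symm ?_), hx⟩, rfl⟩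
        refine hf.localIso_ball ?_ ?_
        · intro z hz
          rw [hfs]
          have := mem_ballAround_trans hx hz
          rwa [show 2 * s + 1 + s = 3 * s + 1 by ring] at this
        · intro z hz
          rw [hft]
          have := mem_ballAround_trans
            (hf.map_ballAround (r := 3 * s + 1) (X := X) hfs.ge (by lia) hx) hz
          rwa [show 2 * s + 1 + s = 3 * s + 1 by ring] at this
      have hTle : T.encard ≤ (S ∩ ballAround A X (2 * s + 1)).encard :=
        (Set.encard_le_encard hTsub).trans (Set.encard_image_le _ _)
      have hSlt : (S ∩ ballAround A X (2 * s + 1)).encard < S.encard := by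
        refine Set.Finite.encard_lt_encard (Set.finite_of_encard_le_coe hPfin) ?_
        refine Set.inter_subset_left.ssubset_of_ne fun h => ?_
        have : a ∈ S := SameType.refl s a
        rw [← h] at this
        exact ha this.2
      rcases (hAB A a).encard with h | ⟨-, h⟩
      · exact absurd (hTle.trans_lt hSlt) (by rw [h]; exact lt_irrefl _)
      · have := h.trans (hTle.trans hPfin)
        exact absurd ht (not_lt.2 (by exact_mod_cast this))
    obtain ⟨g, hg, hgs, hgt, -, rfl⟩ := hab
    have h1 : ballAround A X s ⊆ f.source := by
      rw [hfs]; exact ballAround_mono subset_rfl (by lia)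
    have h2 : ballAround B (f '' X) s ⊆ f.target := by
      rw [hft]; exact ballAround_mono subset_rfl (by lia)
    obtain ⟨h3, h4, h5⟩ := hf.exists_restr_ballAround h1 h2
    obtain ⟨F, hF, hFs, hFt, hFf, hFg⟩ := exists_partialIso_union h3 hg h4 h5 hgs hgt ha hb
    have hFX : ∀ x ∈ X, F x = f x := fun x hx => hFf x (h4.ge (subset_ballAround X s hx))
    refine ⟨F, hF, by rw [hFs, ballAround_insert], ?_, hFX⟩
    rw [hFt, Set.image_insert_eq, ballAround_insert, hFg a (hgs ▸ mem_ball_self a s),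
      Set.image_congr hFX]

/-- Starting position of the game. A `PartialEquiv` carries total maps, so even the empty one needs
a point of `B`, which a positive threshold supplies. -/
theorem HanfEq.exists_empty_partialIso {s t : ℕ} (h : HanfEq s t A B) (ht : 0 < t)
    [hA : Nonempty A] : ∃ f : PartialEquiv A B, IsPartialIso f ∧ f.source = ∅ ∧ f.target = ∅ := by
  obtain ⟨a⟩ := hA
  obtain ⟨b, hb⟩ : {b : B | SameType s A a B b}.Nonempty := by
    have hne : {x : A | SameType s A a A x}.Nonempty := ⟨a, SameType.refl s a⟩
    rw [← Set.encard_pos] at hne ⊢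
    rcases (h A a).encard with h | ⟨-, h⟩
    · rwa [← h]
    · exact lt_of_lt_of_le (by exact_mod_cast ht) h
  obtain ⟨f, hf, -⟩ := hb
  refine ⟨f.restr ∅, hf.restr ∅, by simp, by simp⟩

end BackAndForth

/-! ### Hanf's theorem in bounded degree. -/

section Hanf

variable {L : FirstOrder.Language.{u, v}}

/-- Agreement on a bounded formula is preserved by partial isomorphisms of large balls. -/
theorem exists_realize_iff_of_hanfEq [L.IsRelational] (d : ℕ) {n : ℕ}
    (φ : L.BoundedFormula Empty n) :
    ∃ r t : ℕ, ∀ A B : Str.{u, v, w} L, DegreeBounded d A → DegreeBounded d B →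
      HanfEq r t A B → ∀ f : PartialEquiv A B, IsPartialIso f → ∀ xs : Fin n → A,
        ballAround A (range xs) r ⊆ f.source → ballAround B (range (f ∘ xs)) r ⊆ f.target →
        ∀ (v : Empty → A) (v' : Empty → B), φ.Realize v xs ↔ φ.Realize v' (f ∘ xs) := by
  have term : ∀ {n : ℕ} (τ : L.Term (Empty ⊕ Fin n)), ∃ i : Fin n,
      ∀ (A : Str.{u, v, w} L) (v : Empty → A) (xs : Fin n → A),
        τ.realize (Sum.elim v xs) = xs i := by
    intro n τ
    cases τ with
    | var x =>
      cases x with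
      | inl e => exact e.elim
      | inr i => exact ⟨i, fun _ _ _ => rfl⟩
    | func f _ => exact isEmptyElim f
  induction φ with
  | falsum => exact ⟨0, 0, fun _ _ _ _ _ _ _ _ _ _ _ _ => Iff.rfl⟩
  | equal τ₁ τ₂ =>
    obtain ⟨i, hi⟩ := term τ₁
    obtain ⟨j, hj⟩ := term τ₂
    refine ⟨0, 0, fun A B _ _ _ f _ xs hs _ v v' => ?_⟩
    have hsrc : ∀ i, xs i ∈ f.source := fun i => hs (subset_ballAround _ _ ⟨i, rfl⟩)
    change _ = _ ↔ _ = _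
    rw [hi, hj, hi, hj]
    exact ⟨fun h => congrArg f h, fun h => f.injOn (hsrc i) (hsrc j) h⟩
  | rel R ts =>
    choose g hg using fun l => term (ts l)
    refine ⟨0, 0, fun A B _ _ _ f hf xs hs _ v v' => ?_⟩
    have hsrc : ∀ i, xs i ∈ f.source := fun i => hs (subset_ballAround _ _ ⟨i, rfl⟩)
    change Structure.RelMap R _ ↔ Structure.RelMap R _
    simp only [hg]
    exact hf _ R _ fun l => hsrc (g l)
  | imp φ ψ ih₁ ih₂ =>
    obtain ⟨r₁, t₁, h₁⟩ := ih₁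
    obtain ⟨r₂, t₂, h₂⟩ := ih₂
    refine ⟨max r₁ r₂, max t₁ t₂, fun A B hA hB hAB f hf xs hs ht v v' => ?_⟩
    rw [BoundedFormula.realize_imp, BoundedFormula.realize_imp,
      h₁ A B hA hB ((hAB.mono_radius (le_max_left _ _)).mono_threshold (le_max_left _ _)) f hf xs
        ((ballAround_mono subset_rfl (le_max_left _ _)).trans hs)
        ((ballAround_mono subset_rfl (le_max_left _ _)).trans ht) v v',
      h₂ A B hA hB ((hAB.mono_radius (le_max_right _ _)).mono_threshold (le_max_right _ _)) f hf xs
        ((ballAround_mono subset_rfl (le_max_right _ _)).trans hs)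
        ((ballAround_mono subset_rfl (le_max_right _ _)).trans ht) v v']
  | @all n φ ih =>
    obtain ⟨s, t, h⟩ := ih
    -- the forth direction, for a partial isomorphism whose domain is exactly a ball
    have forth : ∀ A B : Str.{u, v, w} L, DegreeBounded d A → DegreeBounded d B →
        HanfEq s (max t (n * (d + 1) ^ (2 * s + 1) + 1)) A B →
        ∀ f : PartialEquiv A B, IsPartialIso f → ∀ xs : Fin n → A,
        f.source = ballAround A (range xs) (3 * s + 1) →
        f.target = ballAround B (range (f ∘ xs)) (3 * s + 1) →
        ∀ (v : Empty → A) (v' : Empty → B), φ.all.Realize v' (f ∘ xs) → φ.all.Realize v xs := by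
      intro A B hA hB hAB f hf xs hs ht v v' hall
      rw [BoundedFormula.realize_all] at hall ⊢
      intro a
      have hcard : (range xs).encard ≤ n := by
        rw [← Set.image_univ]
        refine (Set.encard_image_le _ _).trans ?_
        simp [Set.encard_univ]
      obtain ⟨F, hF, hFs, hFt, hFX⟩ := hf.exists_extend hs (by rw [ht, Set.range_comp]) hcard hA
        (Nat.lt_of_lt_of_le (Nat.lt_succ_self _) (le_max_right _ _)) hAB a
      have hsnoc : F ∘ (Fin.snoc xs a : Fin (n + 1) → A) = Fin.snoc (f ∘ xs) (F a) := by
        funext i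
        refine Fin.lastCases ?_ (fun i => ?_) i
        · simp
        · simp [hFX (xs i) ⟨i, rfl⟩]
      have hrange : range (Fin.snoc xs a : Fin (n + 1) → A) = insert a (range xs) := by
        rw [Fin.range_snoc]
      refine (h A B hA hB (hAB.mono_threshold (le_max_left _ _)) F hF (Fin.snoc xs a)
        (by rw [hrange, hFs]) (by rw [Set.range_comp, hrange, hFt]) v v').2 ?_
      rw [hsnoc]
      exact hall (F a)
    -- The radius and threshold required by `exists_extend` for `n` points.
    refine ⟨3 * s + 1, max t (n * (d + 1) ^ (2 * s + 1) + 1),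
      fun A B hA hB hAB f hf xs hs ht v v' => ?_⟩
    rw [Set.range_comp] at ht
    obtain ⟨h3, h4, h5⟩ := hf.exists_restr_ballAround hs ht
    set g := f.restr (ballAround A (range xs) (3 * s + 1)) with hg
    have hgx : g ∘ xs = f ∘ xs := rfl
    rw [← Set.range_comp] at h5
    have hAB' := hAB.mono_radius (show s ≤ 3 * s + 1 by lia)
    rw [← hgx]
    constructor
    · intro hall
      have hxs : g.symm ∘ g ∘ xs = xs := funext fun i =>
        g.left_inv (h4 ▸ subset_ballAround _ _ ⟨i, rfl⟩)
      exact forth B A hB hA hAB'.symm g.symm h3.symm (g ∘ xs) h5 (by rw [hxs]; exact h4) v' v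
        (by rwa [hxs])
    · exact forth A B hA hB hAB' g h3 xs h4 h5 v v'

/-- **Hanf's theorem** for structures of bounded degree. -/
theorem exists_realize_sentence_iff_of_hanfEq [L.IsRelational] (d : ℕ) (φ : L.Sentence) :
    ∃ r t : ℕ, ∀ A B : Str.{u, v, w} L, Nonempty A → DegreeBounded d A → DegreeBounded d B →
      HanfEq r t A B → (A ⊨ φ ↔ B ⊨ φ) := by
  obtain ⟨r, t, h⟩ := exists_realize_iff_of_hanfEq.{u, v, w} d φ
  refine ⟨r, t + 1, fun A B _ hA hB hAB => ?_⟩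
  obtain ⟨f, hf, hs, ht⟩ := hAB.exists_empty_partialIso t.succ_pos
  have := h A B hA hB (hAB.mono_threshold t.le_succ) f hf default
    (by rw [Set.range_eq_empty, ballAround_empty]; exact Set.empty_subset _)
    (by rw [Set.range_eq_empty, ballAround_empty]; exact Set.empty_subset _) default default
  rwa [Subsingleton.elim (f ∘ default) default] at this

/-- Isomorphisms between balls around finite sets can be found in Hanf equivalent structures. -/
theorem exists_partialIso_of_hanfEq (d n R : ℕ) :
    ∃ r t : ℕ, R ≤ r ∧ ∀ A B : Str.{u, v, w} L, Nonempty A → DegreeBounded d A → HanfEq r t A B →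
      ∀ X : Set A, X.encard ≤ n → ∃ F : PartialEquiv A B, IsPartialIso F ∧
        F.source = ballAround A X R ∧ F.target = ballAround B (F '' X) R := by
  induction n generalizing R with
  | zero =>
    refine ⟨R, 1, le_rfl, fun A B _ _ hAB X hX => ?_⟩
    obtain rfl : X = ∅ := by simpa using hX
    obtain ⟨f, hf, hs, ht⟩ := hAB.exists_empty_partialIso one_pos
    exact ⟨f, hf, by rw [hs, ballAround_empty], by rw [ht, Set.image_empty, ballAround_empty]⟩
  | succ n ih =>
    -- Adding one point shrinks the radius from `3 * R + 1` to `R`, so the smaller set needs the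
    -- larger radius.
    obtain ⟨r, t, hr, h⟩ := ih (3 * R + 1)
    refine ⟨r, max t (n * (d + 1) ^ (2 * R + 1) + 1), by lia, fun A B hne hA hAB X hX => ?_⟩
    have key : ∀ Y : Set A, Y.encard ≤ n → ∀ a, ∃ F : PartialEquiv A B, IsPartialIso F ∧
        F.source = ballAround A (insert a Y) R ∧
        F.target = ballAround B (F '' insert a Y) R := by
      intro Y hY a
      obtain ⟨f, hf, hs, ht⟩ := h A B hne hA (hAB.mono_threshold (le_max_left _ _)) Y hY
      obtain ⟨F, hF, hFs, hFt, -⟩ := hf.exists_extend hs ht hY hA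
        (Nat.lt_of_lt_of_le (Nat.lt_succ_self _) (le_max_right _ _))
        (hAB.mono_radius (by lia)) a
      exact ⟨F, hF, hFs, hFt⟩
    rcases X.eq_empty_or_nonempty with rfl | ⟨a, ha⟩
    · obtain ⟨f, hf, hs, ht⟩ :=
        (hAB.mono_threshold (le_max_right _ _)).exists_empty_partialIso (Nat.succ_pos _)
      exact ⟨f, hf, by rw [hs, ballAround_empty], by rw [ht, Set.image_empty, ballAround_empty]⟩
    · have := key (X \ {a}) ?_ a
      · rwa [Set.insert_sdiff_singleton, Set.insert_eq_of_mem ha] at this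
      · have h1 := Set.encard_sdiff_singleton_add_one ha
        rw [← h1] at hX
        push_cast at hX
        exact (ENat.add_le_add_iff_right (by simp)).1 hX

end Hanf

/-! ### Finiteness of the set of types. -/

section Codes

variable {L : FirstOrder.Language.{u, v}}

/-- There are only finitely many isomorphism types of pointed structures of bounded size. -/
theorem exists_finite_code [Finite (Σ n, L.Relations n)] (m : ℕ) :
    ∃ (T : Type v) (_ : Finite T) (code : (A : Str.{u, v, w} L) → Set A → A → T),
      ∀ (A B : Str.{u, v, w} L) (S : Set A) (S' : Set B) (a : A) (b : B),
        S.encard ≤ m → S'.encard ≤ m → a ∈ S → b ∈ S' → code A S a = code B S' b →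
        LocalIso A S a B S' b := by
  classical
  have emb : ∀ (A : Str.{u, v, w} L) (S : Set A), S.encard ≤ m →
      ∃ e : A → Fin (m + 1), InjOn e S := by
    intro A S hS
    have hfin := Set.finite_of_encard_le_coe hS
    have : Fintype S := hfin.fintype
    have hcard : Fintype.card S ≤ Fintype.card (Fin (m + 1)) := by
      rw [Fintype.card_fin, ← Nat.card_eq_fintype_card, Nat.card_coe_set_eq]
      have h1 : (S.ncard : ℕ∞) ≤ m := by rwa [hfin.cast_ncard_eq]
      have h2 : S.ncard ≤ m := by exact_mod_cast h1
      lia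
    obtain ⟨g⟩ := Function.Embedding.nonempty_of_card_le hcard
    refine ⟨fun x => if h : x ∈ S then g ⟨x, h⟩ else 0, fun x hx y hy h => ?_⟩
    simp only [dif_pos hx, dif_pos hy] at h
    exact congrArg Subtype.val (g.injective h)
  let e : (A : Str.{u, v, w} L) → Set A → A → Fin (m + 1) := fun A S =>
    if h : S.encard ≤ m then (emb A S h).choose else fun _ => 0
  have he : ∀ (A : Str.{u, v, w} L) (S : Set A), S.encard ≤ m → InjOn (e A S) S := by
    intro A S h
    simp only [e, dif_pos h]
    exact (emb A S h).choose_spec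
  -- The code is the copy of the pointed structure under an arbitrarily chosen numbering. Isomorphic
  -- structures may get different codes; only the converse implication is needed.
  refine ⟨Set (Fin (m + 1)) × (∀ p : Σ n, L.Relations n, Set (Fin p.1 → Fin (m + 1))) ×
    Fin (m + 1), inferInstance, fun A S a => (e A S '' S,
      fun p => {c | ∃ c' : Fin p.1 → A, (∀ i, c' i ∈ S) ∧ Structure.RelMap p.2 c' ∧
        e A S ∘ c' = c}, e A S a), ?_⟩
  intro A B S S' a b hS hS' ha hb hcode
  rw [Prod.mk.injEq, Prod.mk.injEq] at hcode
  obtain ⟨h1, h2, h3⟩ := hcode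
  have hA := he A S hS
  have hB := he B S' hS'
  have hne : Nonempty A := ⟨a⟩
  have hne' : Nonempty B := ⟨b⟩
  let f : PartialEquiv A (Fin (m + 1)) := hA.toPartialEquiv
  let g : PartialEquiv B (Fin (m + 1)) := hB.toPartialEquiv
  have hfT : f.target = g.target := h1
  have src : (f.trans g.symm).source = S := by
    rw [PartialEquiv.trans_source]
    refine Set.inter_eq_self_of_subset_left fun x hx => ?_
    change f x ∈ g.target
    rw [← hfT]
    exact f.map_source hx
  have tgt : (f.trans g.symm).target = S' := by
    rw [PartialEquiv.trans_target]
    refine Set.inter_eq_self_of_subset_left fun x hx => ?_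
    change g x ∈ f.target
    rw [hfT]
    exact g.map_source hx
  have hgf : ∀ x ∈ S, (f.trans g.symm) x ∈ S' ∧ e B S' ((f.trans g.symm) x) = e A S x := by
    intro x hx
    refine ⟨tgt ▸ (f.trans g.symm).map_source (src.ge hx), ?_⟩
    exact g.right_inv (hfT ▸ f.map_source hx)
  refine ⟨f.trans g.symm, ?_, src, tgt, ha, ?_⟩
  · intro n r c hc
    rw [src] at hc
    have h2' := congrFun h2 ⟨n, r⟩
    constructor
    · intro hr
      have hmem : e A S ∘ c ∈ {c₀ | ∃ c' : Fin n → A, (∀ i, c' i ∈ S) ∧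
        Structure.RelMap r c' ∧ e A S ∘ c' = c₀} := ⟨c, hc, hr, rfl⟩
      obtain ⟨c', hc', hr', heq⟩ := h2'.le hmem
      have : c' = f.trans g.symm ∘ c := funext fun i =>
        hB (hc' i) (hgf _ (hc i)).1 ((congrFun heq i).trans (hgf _ (hc i)).2.symm)
      rwa [← this]
    · intro hr
      have hmem : e B S' ∘ (f.trans g.symm ∘ c) ∈ {c₀ | ∃ c' : Fin n → B, (∀ i, c' i ∈ S') ∧
        Structure.RelMap r c' ∧ e B S' ∘ c' = c₀} := ⟨_, fun i => (hgf _ (hc i)).1, hr, rfl⟩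
      obtain ⟨c', hc', hr', heq⟩ := h2'.ge hmem
      have : c' = c := funext fun i =>
        hA (hc' i) (hc i) ((congrFun heq i).trans (hgf _ (hc i)).2)
      rwa [← this]
  · exact hB (hgf a ha).1 hb ((hgf a ha).2.trans h3)

end Codes

instance instIsRelationalSingleRel (k : ℕ) : (singleRel k).IsRelational :=
  fun _ => inferInstanceAs (IsEmpty Empty)

theorem finite_relations_withRel {L : FirstOrder.Language.{u, v}} [Finite (Σ n, L.Relations n)]
    (k : ℕ) : Finite (Σ n, (withRel L k).Relations n) := by
  refine Finite.of_surjective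
    (fun x : (Σ n, L.Relations n) ⊕ Unit => show Σ n, (withRel L k).Relations n from
      x.elim (fun p => ⟨p.1, Sum.inl p.2⟩) fun _ => ⟨k, Sum.inr RelSymbol.R⟩) ?_
  rintro ⟨n, r | r⟩
  · exact ⟨Sum.inl ⟨n, r⟩, rfl⟩
  · cases r
    exact ⟨Sum.inr (), rfl⟩

/-! ### Presentations, their transport and extension. -/

section Presentations

variable {L : FirstOrder.Language.{u, v}} {A B : Str.{u, v, w} L} {k : ℕ}

theorem isPartialIso_expand_iff {ρ : (Fin k → A) → Prop} {σ : (Fin k → B) → Prop}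
    {f : PartialEquiv A B} :
    IsPartialIso (A := expand A ρ) (B := expand B σ) f ↔
      IsPartialIso f ∧ ∀ c : Fin k → A, (∀ i, c i ∈ f.source) → (ρ c ↔ σ (f ∘ c)) := by
  constructor
  · intro h
    exact ⟨fun n r => h n (Sum.inl r), h k (Sum.inr RelSymbol.R)⟩
  · rintro ⟨h, h'⟩ n (r | r)
    · exact h n r
    · cases r
      exact h'

/-- The relations `ρ` and `σ` agree on tuples from `U`. -/
def AgreeOn {α : Type*} (U : Set α) (ρ σ : (Fin k → α) → Prop) : Prop :=
  ∀ c : Fin k → α, (∀ i, c i ∈ U) → (ρ c ↔ σ c)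

theorem AgreeOn.mono {α : Type*} {U V : Set α} {ρ σ : (Fin k → α) → Prop} (h : AgreeOn V ρ σ)
    (hU : U ⊆ V) : AgreeOn U ρ σ :=
  fun c hc => h c fun i => hU (hc i)

/-- The isomorphism induced on expansions. -/
def expandEquiv {ρ : (Fin k → A) → Prop} {σ : (Fin k → B) → Prop} (e : A ≃[L] B)
    (h : ∀ c, ρ c ↔ σ (e ∘ c)) : expand A ρ ≃[withRel L k] expand B σ where
  toEquiv := e.toEquiv
  map_fun' := by
    rintro n (f | f) x
    · exact e.map_fun f x
    · exact f.elim
  map_rel' := by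
    rintro n (r | r) x
    · exact e.map_rel r x
    · cases r
      exact (h x).symm

/-- The substructure of `A` with universe `U`. -/
def induced [L.IsRelational] (A : Str.{u, v, w} L) (U : Set A) : L.Substructure A where
  carrier := U
  fun_mem := fun f => isEmptyElim f

/-- A partial isomorphism, as an isomorphism of induced substructures. -/
def inducedEquiv [L.IsRelational] {f : PartialEquiv A B} (hf : IsPartialIso f) :
    induced A f.source ≃[L] induced B f.target where
  toEquiv := f.toEquiv
  map_fun' := fun q => isEmptyElim q
  map_rel' := fun {n} q x => (hf n q (fun i => (x i).1) fun i => (x i).2).symm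

namespace PresentationScheme

variable {K : Set (Str.{u, v, w} L)} (P : PresentationScheme K k)

/-- Elementarity enters the proof only here, through the isomorphism invariance of first-order
truth. -/
theorem IsElementary.pres_of_equiv {P : PresentationScheme K k} (hP : P.IsElementary)
    (hB : B ∈ K) {ρ : (Fin k → A) → Prop} {σ : (Fin k → B) → Prop}
    (e : A ≃[L] B) (h : ∀ c, ρ c ↔ σ (e ∘ c)) (hρ : P.Pres A ρ) : P.Pres B σ := by
  obtain ⟨θ, hθ⟩ := hP
  rw [hθ B hB σ]
  rw [hθ A (P.mem_of_pres A ρ hρ) ρ] at hρ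
  exact (StrongHomClass.realize_sentence (expandEquiv e h) θ).1 hρ

variable [L.IsRelational]

/-- The restriction of `ρ` to `U` is a presentation of the structure induced on `U`. -/
def PresOn (A : Str.{u, v, w} L) (U : Set A) (ρ : (Fin k → A) → Prop) : Prop :=
  P.Pres (subStr (induced A U)) (restrictRel ρ (induced A U))

variable {P}

theorem IsElementary.presOn_of_isPartialIso (hP : P.IsElementary) (hK : SubstructureClosed K)
    (hB : B ∈ K) {ρ : (Fin k → A) → Prop} {σ : (Fin k → B) → Prop} {f : PartialEquiv A B}
    (hf : IsPartialIso (A := expand A ρ) (B := expand B σ) f) (hne : f.target.Nonempty)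
    (hρ : P.PresOn A f.source ρ) : P.PresOn B f.target σ := by
  obtain ⟨h1, h2⟩ := isPartialIso_expand_iff.1 hf
  exact hP.pres_of_equiv (A := subStr (induced A f.source)) (B := subStr (induced B f.target))
    (hK B hB _ hne) (inducedEquiv h1)
    (fun c => h2 (fun i => (c i).1) fun i => (c i).2) hρ

theorem IsElementary.pres_of_presOn_univ (hP : P.IsElementary) (hA : A ∈ K)
    {ρ : (Fin k → A) → Prop} (hρ : P.PresOn A Set.univ ρ) : P.Pres A ρ :=
  hP.pres_of_equiv (A := subStr (induced A Set.univ)) (B := A) hA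
    (Substructure.topEquiv : (⊤ : L.Substructure A) ≃[L] A) (fun _ => Iff.rfl) hρ

theorem HasLocalization.presOn (hP : P.HasLocalization) (hA : A ∈ K) {ρ : (Fin k → A) → Prop}
    (hρ : P.Pres A ρ) {U : Set A} (hU : U.Finite) (hne : U.Nonempty) : P.PresOn A U ρ :=
  hP A hA ρ hρ (induced A U) hU hne

theorem agreeOn_of_restrictRel_eq {U : Set A} {ρ σ : (Fin k → A) → Prop}
    (h : restrictRel ρ (induced A U) = restrictRel σ (induced A U)) : AgreeOn U ρ σ :=
  fun c hc => iff_of_eq (congrFun h fun i => ⟨c i, hc i⟩)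

theorem IsLocal.exists_amalgam (hP : P.IsLocal) (hA : A ∈ K) {U V : Set A} (hU : U.Finite)
    (hUne : U.Nonempty) (hV : V.Finite) (hVne : V.Nonempty) (hUV : Disjoint U V)
    {ρ σ : (Fin k → A) → Prop} (hρ : P.PresOn A U ρ) (hσ : P.PresOn A V σ) :
    ∃ τ, P.Pres A τ ∧ AgreeOn U τ ρ ∧ AgreeOn V τ σ := by
  obtain ⟨τ, hτ, h1, h2⟩ := hP.2 A hA (induced A U) (induced A V) hU hUne hV hVne hUV _ _ hρ hσ
  exact ⟨τ, hτ, agreeOn_of_restrictRel_eq h1, agreeOn_of_restrictRel_eq h2⟩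

/-- Amalgamation with any presentation of a single point outside `U`. If no such point exists, `U`
is everything and `ρ` itself serves. -/
theorem IsLocal.exists_extension (hP : P.IsLocal) (hel : P.IsElementary)
    (hK : SubstructureClosed K) (hA : A ∈ K) {U : Set A} (hU : U.Finite) (hUne : U.Nonempty)
    {ρ : (Fin k → A) → Prop} (hρ : P.PresOn A U ρ) : ∃ τ, P.Pres A τ ∧ AgreeOn U τ ρ := by
  by_cases hcov : ∃ a, a ∉ U
  · obtain ⟨a, ha⟩ := hcov
    have hmem : subStr (induced A {a}) ∈ K := hK A hA _ (Set.singleton_nonempty a)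
    obtain ⟨σ, hσ⟩ := P.exists_pres _ hmem
    obtain ⟨τ, hτ, h1, -⟩ := hP.2 A hA (induced A U) (induced A {a}) hU hUne
      (Set.finite_singleton a) (Set.singleton_nonempty a) (Set.disjoint_singleton_right.2 ha) _ _
      hρ hσ
    exact ⟨τ, hτ, agreeOn_of_restrictRel_eq h1⟩
  · push Not at hcov
    obtain rfl : U = Set.univ := Set.eq_univ_of_forall hcov
    exact ⟨ρ, hel.pres_of_presOn_univ hA hρ, fun _ _ => Iff.rfl⟩

end PresentationScheme

/-- The relation on `B` obtained from a relation on `A` along `f`. -/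
def transferRel (f : PartialEquiv A B) (ρ : (Fin k → A) → Prop) : (Fin k → B) → Prop :=
  fun c => ρ (f.symm ∘ c)

theorem IsPartialIso.expand_transferRel {f : PartialEquiv A B} (hf : IsPartialIso f)
    (ρ : (Fin k → A) → Prop) :
    IsPartialIso (A := expand A ρ) (B := expand B (transferRel f ρ)) f := by
  refine isPartialIso_expand_iff.2 ⟨hf, fun c hc => ?_⟩
  have : f.symm ∘ f ∘ c = c := funext fun i => f.left_inv (hc i)
  rw [transferRel, this]

theorem IsPartialIso.expand_congr {f : PartialEquiv A B} {ρ ρ' : (Fin k → A) → Prop}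
    {σ σ' : (Fin k → B) → Prop} (hf : IsPartialIso (A := expand A ρ) (B := expand B σ) f)
    (hρ : AgreeOn f.source ρ' ρ) (hσ : AgreeOn f.target σ' σ) :
    IsPartialIso (A := expand A ρ') (B := expand B σ') f := by
  obtain ⟨h1, h2⟩ := isPartialIso_expand_iff.1 hf
  refine isPartialIso_expand_iff.2 ⟨h1, fun c hc => ?_⟩
  exact (hρ c hc).trans ((h2 c hc).trans (hσ (f ∘ c) fun i => f.map_source (hc i)).symm)

/-- The balls of radius `R` around `a` and `b` in the Gaifman graphs of `A` and `B`, expanded by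
`ρ` and `σ`, are isomorphic as pointed structures. -/
def SamePresType (R : ℕ) (A : Str.{u, v, w} L) (ρ : (Fin k → A) → Prop) (a : A)
    (B : Str.{u, v, w} L) (σ : (Fin k → B) → Prop) (b : B) : Prop :=
  LocalIso (expand A ρ) (ball A a R) a (expand B σ) (ball B b R) b

/-- Since the balls are taken before expanding, the type depends on the presentation only through
tuples inside the ball. Amalgamation can therefore control it. -/
theorem SamePresType.congr {R : ℕ} {a : A} {b : B} {ρ ρ' : (Fin k → A) → Prop}
    {σ σ' : (Fin k → B) → Prop} (h : SamePresType R A ρ a B σ b)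
    (hρ : AgreeOn (ball A a R) ρ' ρ) (hσ : AgreeOn (ball B b R) σ' σ) :
    SamePresType R A ρ' a B σ' b := by
  obtain ⟨f, hf, hS, hT, ha, hb⟩ := h
  exact ⟨f, IsPartialIso.expand_congr (A := A) (B := B) (f := f) hf (by rw [hS]; exact hρ) (by rw [hT]; exact hσ),
    hS, hT, ha, hb⟩

/-- `ν` is a neighborhood expansion factor for the presentation `ρ` of `A`. -/
def IsExpansionFactor (ν : ℕ) (A : Str.{u, v, w} L) (ρ : (Fin k → A) → Prop) : Prop :=
  ∀ a : A, ball (expand A ρ) a 1 ⊆ ball A a ν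

theorem IsExpansionFactor.ball_subset {ν : ℕ} {ρ : (Fin k → A) → Prop}
    (h : IsExpansionFactor ν A ρ) (a : A) (s : ℕ) : ball (expand A ρ) a s ⊆ ball A a (ν * s) := by
  induction s with
  | zero =>
    intro b hb
    rw [mem_ball_zero.1 hb]
    exact mem_ball_self _ _
  | succ s ih =>
    intro b hb
    obtain ⟨c, hc, hbc⟩ := exists_mem_ball_of_succ hb
    exact mem_ball_trans (ih hc) (h c hbc)

theorem IsExpansionFactor.degreeBounded {ν d : ℕ} {ρ : (Fin k → A) → Prop}
    (h : IsExpansionFactor ν A ρ) (hd : DegreeBounded d A) :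
    DegreeBounded ((d + 1) ^ ν) (expand A ρ) := by
  intro a
  refine (Set.encard_le_encard ?_).trans (hd.encard_ball_le a ν)
  exact fun b hb => h a (mem_ball_one.2 (Or.inr hb))

/-- The `s`-balls of the expansions lie inside the `R`-balls, so the isomorphism restricts to them.
-/
theorem SamePresType.sameType_expand {ν s R : ℕ} {a : A} {b : B} {ρ : (Fin k → A) → Prop}
    {σ : (Fin k → B) → Prop} (h : SamePresType R A ρ a B σ b) (hR : ν * s ≤ R)
    (hρ : IsExpansionFactor ν A ρ) (hσ : IsExpansionFactor ν B σ) :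
    SameType s (expand A ρ) a (expand B σ) b := by
  obtain ⟨f, hf, hS, hT, ha, rfl⟩ := h
  exact hf.localIso_ball ((hρ.ball_subset a s).trans ((ball_mono hR).trans hS.ge))
    ((hσ.ball_subset _ s).trans ((ball_mono hR).trans hT.ge))

end Presentations

/-! ### Rare and frequent neighborhood types. -/

section RareTypes

variable {L : FirstOrder.Language.{u, v}} {A B : Str.{u, v, w} L}

/-- The points of `A` whose `R`-neighborhood type is realized fewer than `s` times in `A`. -/
def rare (R s : ℕ) (A : Str.{u, v, w} L) : Set A :=
  {a | {x : A | SameType R A a A x}.encard < s}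

theorem SameType.encard_eq {C D : Str.{u, v, w} L} {R : ℕ} {c : C} {e : D}
    (h : SameType R C c D e) :
    {x : A | SameType R C c A x}.encard = {x : A | SameType R D e A x}.encard :=
  congrArg Set.encard (Set.ext fun _ => ⟨h.symm.trans, h.trans⟩)

theorem HanfEq.mem_rare_iff {R s t : ℕ} (h : HanfEq R t A B) (hst : s ≤ t) {a : A} {b : B}
    (hab : SameType R A a B b) : a ∈ rare R s A ↔ b ∈ rare R s B := by
  change {x : A | SameType R A a A x}.encard < s ↔ {x : B | SameType R B b B x}.encard < s
  rw [← SameType.encard_eq (A := B) hab]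
  have hst' : (s : ℕ∞) ≤ t := by exact_mod_cast hst
  rcases (h A a).encard with h | ⟨h1, h2⟩
  · rw [h]
  · exact iff_of_false (not_lt.2 (hst'.trans h1)) (not_lt.2 (hst'.trans h2))

/-- Rare points sharing a code share a type, so there are fewer than `s` of them. `N` counts codes
and must not depend on `s`, because the gap function is built from it. -/
theorem exists_encard_rare_le [Finite (Σ n, L.Relations n)] (d R : ℕ) :
    ∃ N : ℕ, ∀ A : Str.{u, v, w} L, DegreeBounded d A → ∀ s : ℕ,
      (rare R s A).encard ≤ ((N * s : ℕ) : ℕ∞) := by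
  obtain ⟨T, hT, code, hcode⟩ := exists_finite_code.{u, v, w} (L := L) ((d + 1) ^ R)
  refine ⟨Nat.card T, fun A hA s => ?_⟩
  have hsub : rare R s A ⊆ ⋃ τ ∈ (Set.univ : Set T),
      {a | a ∈ rare R s A ∧ code A (ball A a R) a = τ} := fun a ha => by
    simpa using ha
  refine (Set.encard_le_encard hsub).trans (encard_biUnion_le ?_ fun τ _ => ?_)
  · rw [Set.encard_univ, ENat.card_eq_coe_natCard]
  · rcases Set.eq_empty_or_nonempty {a | a ∈ rare R s A ∧ code A (ball A a R) a = τ} with h | h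
    · rw [h]; simp
    · obtain ⟨a, ha, haτ⟩ := h
      refine (Set.encard_le_encard ?_).trans (le_of_lt ha)
      rintro x ⟨-, hx⟩
      exact hcode A A _ _ a x (hA.encard_ball_le a R) (hA.encard_ball_le x R)
        (mem_ball_self a R) (mem_ball_self x R) (haτ.trans hx.symm)

/-- There is a gap in the multiplicities of neighborhood types of structures of bounded degree. -/
theorem exists_gap [Finite (Σ n, L.Relations n)] (d R : ℕ) (g : ℕ → ℕ) (hg : ∀ n, n ≤ g n) :
    ∃ M : ℕ, ∀ A : Str.{u, v, w} L, DegreeBounded d A → ∃ s : ℕ, 0 < s ∧ g s ≤ M ∧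
      ∀ a ∉ rare R s A, (g s : ℕ∞) ≤ {x : A | SameType R A a A x}.encard := by
  obtain ⟨T, hT, code, hcode⟩ := exists_finite_code.{u, v, w} (L := L) ((d + 1) ^ R)
  have hmono : Monotone fun n => g^[n] 1 := monotone_nat_of_le_succ fun n => by
    rw [Function.iterate_succ_apply']
    exact hg _
  refine ⟨g^[Nat.card T + 1] 1, fun A hA => ?_⟩
  by_contra hcon
  push Not at hcon
  have hpos : ∀ n, 0 < g^[n] 1 := fun n => hmono (Nat.zero_le n)
  -- If no iterate of `g` works as `s`, each of the `Nat.card T + 1` disjoint intervals between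
  -- successive iterates contains the multiplicity of some type: more types than codes.
  have hstep : ∀ i : Fin (Nat.card T + 1), ∃ a : A,
      (g^[i] 1 : ℕ∞) ≤ {x : A | SameType R A a A x}.encard ∧
      {x : A | SameType R A a A x}.encard < (g^[i + 1] 1 : ℕ) := by
    intro i
    obtain ⟨a, ha, ha'⟩ := hcon (g^[i] 1) (hpos i) (by
      rw [← Function.iterate_succ_apply' g]
      exact hmono (Nat.succ_le_of_lt i.2))
    refine ⟨a, not_lt.1 ha, ?_⟩
    rwa [← Function.iterate_succ_apply' g] at ha'
  choose a ha ha' using hstep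
  have hnot : ¬ Function.Injective fun i => code A (ball A (a i) R) (a i) := by
    intro hinj
    have := Nat.card_le_card_of_injective _ hinj
    rw [Nat.card_eq_fintype_card, Fintype.card_fin] at this
    lia
  have contra : ∀ i j : Fin (Nat.card T + 1), i < j →
      code A (ball A (a i) R) (a i) ≠ code A (ball A (a j) R) (a j) := by
    intro i j hij heq
    have hsame : SameType R A (a i) A (a j) :=
      hcode A A _ _ _ _ (hA.encard_ball_le _ R) (hA.encard_ball_le _ R) (mem_ball_self _ R)
        (mem_ball_self _ R) heq
    have h1 := (ha j).trans_lt (hsame.encard_eq (A := A) ▸ ha' i)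
    have h2 : g^[j] 1 < g^[i + 1] 1 := by exact_mod_cast h1
    exact absurd (hmono (Nat.succ_le_of_lt hij)) (not_le.2 h2)
  refine hnot fun i j hij => ?_
  by_contra hne
  rcases lt_or_gt_of_ne hne with h | h
  · exact contra i j h hij
  · exact contra j i h hij.symm

theorem IsPartialIso.sameType_of_source {F : PartialEquiv A B} (hF : IsPartialIso F) {X : Set A}
    {R : ℕ} (hs : F.source = ballAround A X R) (ht : F.target = ballAround B (F '' X) R) {x : A}
    (hx : x ∈ X) : SameType R A x B (F x) :=
  hF.localIso_ball (hs ▸ ball_subset_ballAround hx R)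
    (ht ▸ ball_subset_ballAround (Set.mem_image_of_mem F hx) R)

/-- A partial isomorphism defined around all rare points of `A` maps them onto those of `B`. -/
theorem HanfEq.image_rare {R s t n : ℕ} (hAB : HanfEq R t A B) (hst : s ≤ t)
    (hfin : (rare R s A).encard ≤ n) {F : PartialEquiv A B} (hF : IsPartialIso F) {X : Set A}
    (hs : F.source = ballAround A X R) (ht : F.target = ballAround B (F '' X) R)
    (hX : rare R s A ⊆ X) {G : PartialEquiv B A} (hG : IsPartialIso G)
    (hGs : G.source = ballAround B (rare R s B) R)
    (hGt : G.target = ballAround A (G '' rare R s B) R) : F '' rare R s A = rare R s B := by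
  have hsub : F '' rare R s A ⊆ rare R s B := by
    rintro _ ⟨a, ha, rfl⟩
    exact (hAB.mem_rare_iff hst (hF.sameType_of_source hs ht (hX ha))).1 ha
  have hsub' : G '' rare R s B ⊆ rare R s A := by
    rintro _ ⟨b, hb, rfl⟩
    exact (hAB.mem_rare_iff hst (hG.sameType_of_source hGs hGt hb).symm).2 hb
  have hFinj : InjOn F (rare R s A) :=
    F.injOn.mono (hX.trans (hs ▸ subset_ballAround X R))
  have hGinj : InjOn G (rare R s B) := G.injOn.mono (hGs ▸ subset_ballAround _ R)
  -- `G` serves only to compare cardinalities; finiteness turns the inclusion `hsub` into equality.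
  have hle : (rare R s B).encard ≤ (F '' rare R s A).encard := by
    rw [hFinj.encard_image, ← hGinj.encard_image]
    exact Set.encard_le_encard hsub'
  exact ((Set.finite_of_encard_le_coe hfin).image F).eq_of_subset_of_encard_le hsub hle

theorem HanfEq.exists_sameType {R t : ℕ} (h : HanfEq R t A B) (ht : 0 < t) (b : B) :
    ∃ a : A, SameType R B b A a := by
  have hne : {x : B | SameType R B b B x}.Nonempty := ⟨b, SameType.refl R b⟩
  change {x : A | SameType R B b A x}.Nonempty
  rw [← Set.encard_pos] at hne ⊢
  rcases (h B b).encard with h | ⟨h, -⟩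
  · rwa [h]
  · exact lt_of_lt_of_le (by exact_mod_cast ht) h

theorem natCast_le_encard_of_injective {α : Type*} {S : Set α} {t : ℕ} {x : Fin t → α}
    (hx : Function.Injective x) (h : ∀ i, x i ∈ S) : (t : ℕ∞) ≤ S.encard := by
  refine le_trans (le_of_eq ?_) (Set.encard_le_encard (Set.range_subset_iff.2 h))
  rw [← Set.image_univ, hx.encard_image, Set.encard_univ]
  simp

end RareTypes

/-! ### Realizing prescribed presentations of frequent neighborhoods. -/

section Realization

variable {L : FirstOrder.Language.{u, v}} {A B : Str.{u, v, w} L} {k : ℕ}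

theorem IsPartialIso.samePresType {F : PartialEquiv A B} {ρ : (Fin k → A) → Prop}
    {σ : (Fin k → B) → Prop} (hF : IsPartialIso (A := expand A ρ) (B := expand B σ) F)
    {X : Set A} {R : ℕ} (hs : F.source = ballAround A X R)
    (ht : F.target = ballAround B (F '' X) R) {x : A} (hx : x ∈ X) :
    SamePresType R A ρ x B σ (F x) := by
  have h1 : ballAround A {x} R ⊆ F.source :=
    hs ▸ ballAround_mono (Set.singleton_subset_iff.2 hx) le_rfl
  have h2 : ballAround B (F '' {x}) R ⊆ F.target :=
    ht ▸ ballAround_mono (Set.image_mono (Set.singleton_subset_iff.2 hx)) le_rfl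
  obtain ⟨-, h3, h4⟩ := (isPartialIso_expand_iff.1 hF).1.exists_restr_ballAround h1 h2
  rw [Set.image_singleton, ballAround_singleton] at h4
  rw [ballAround_singleton] at h3 h4
  exact ⟨F.restr (ball A x R), IsPartialIso.restr (A := expand A ρ) (B := expand B σ) hF _, h3, h4,
    mem_ball_self x R, rfl⟩

variable [L.IsRelational] {K : Set (Str.{u, v, w} L)} {P : PresentationScheme K k}

theorem LocalIso.presOn_transfer (hel : P.IsElementary) (hK : SubstructureClosed K) (hB : B ∈ K)
    {R : ℕ} {a : A} {b : B} (h : SameType R A a B b) {ρ : (Fin k → A) → Prop}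
    (hρ : P.PresOn A (ball A a R) ρ) :
    ∃ σ, P.PresOn B (ball B b R) σ ∧ SamePresType R A ρ a B σ b := by
  obtain ⟨f, hf, hS, hT, ha, hb⟩ := h
  have hf' := hf.expand_transferRel ρ
  refine ⟨transferRel f ρ, ?_, f, hf', hS, hT, ha, hb⟩
  rw [← hT]
  exact hel.presOn_of_isPartialIso hK hB hf' (by rw [hT]; exact ⟨b, mem_ball_self b R⟩)
    (by rwa [hS])

/-- A presentation of `A` can be chosen so that it realizes given presentations of frequent
neighborhoods. -/
theorem exists_pres_realizing (hloc : P.IsLocal) (hel : P.IsElementary)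
    (hK : SubstructureClosed K) (hA : A ∈ K) {d n R : ℕ} (hd : DegreeBounded d A) {X₀ : Set A}
    (hX₀ : X₀.Nonempty) (hX₀n : X₀.encard ≤ n) {ι : Type*} [Fintype ι] (a : ι → A)
    (ρ : ι → (Fin k → A) → Prop) (hρ : ∀ i, P.PresOn A (ball A (a i) R) (ρ i))
    (hbig : ∀ i, (((n + Fintype.card ι) * (d + 1) ^ (2 * R + 1) : ℕ) : ℕ∞) <
      {x : A | SameType R A (a i) A x}.encard) :
    ∃ (X : Set A) (x : ι → A) (σ : (Fin k → A) → Prop), X₀ ⊆ X ∧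
      X.encard ≤ ((n + Fintype.card ι : ℕ) : ℕ∞) ∧ P.Pres A σ ∧ Function.Injective x ∧
      (∀ i, x i ∈ X) ∧ ∀ i, SamePresType R A (ρ i) (a i) A σ (x i) := by
  classical
  have key : ∀ J : Finset ι, ∃ (X : Set A) (x : ι → A) (σ : (Fin k → A) → Prop), X₀ ⊆ X ∧
      X.encard ≤ ((n + J.card : ℕ) : ℕ∞) ∧ P.Pres A σ ∧ InjOn x J ∧
      (∀ i ∈ J, x i ∈ X) ∧ ∀ i ∈ J, SamePresType R A (ρ i) (a i) A σ (x i) := by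
    intro J
    induction J using Finset.induction_on with
    | empty =>
      obtain ⟨σ, hσ⟩ := P.exists_pres A hA
      exact ⟨X₀, a, σ, subset_rfl, by simpa using hX₀n, hσ, by simp, by simp, by simp⟩
    | insert i J hi ih =>
      obtain ⟨X, x, σ, hXX, hXn, hσ, hinj, hmem, hreal⟩ := ih
      have hJ : J.card ≤ Fintype.card ι := Finset.card_le_univ J
      -- The type has more realizations than the `(2R+1)`-ball around `X` has points.
      obtain ⟨y, hy, hyX⟩ : ∃ y, SameType R A (a i) A y ∧ y ∉ ballAround A X (2 * R + 1) := by
        by_contra hcon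
        push Not at hcon
        have h1 := (Set.encard_le_encard
          (show {x : A | SameType R A (a i) A x} ⊆ ballAround A X (2 * R + 1) from
            fun y hy => hcon y hy)).trans (hd.encard_ballAround_le hXn (2 * R + 1))
        have h2 := (hbig i).trans_le h1
        have h3 : (n + Fintype.card ι) * (d + 1) ^ (2 * R + 1) <
          (n + J.card) * (d + 1) ^ (2 * R + 1) := by exact_mod_cast h2
        exact absurd (Nat.mul_le_mul_right ((d + 1) ^ (2 * R + 1)) (Nat.add_le_add_left hJ n))
          (not_le.2 h3)
      have hyX' : y ∉ X := fun h => hyX (subset_ballAround X _ h)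
      obtain ⟨τ, hτ, hτi⟩ := LocalIso.presOn_transfer hel hK hA hy (hρ i)
      have hfinX : (ballAround A X R).Finite :=
        Set.finite_of_encard_le_coe (hd.encard_ballAround_le hXn R)
      have hneX : (ballAround A X R).Nonempty :=
        hX₀.mono (hXX.trans (subset_ballAround X R))
      -- The old presentation is kept only around `X`. It may change elsewhere, which affects none
      -- of the types already realized.
      obtain ⟨σ', hσ', hagX, hagy⟩ := hloc.exists_amalgam hA hfinX hneX
        (Set.finite_of_encard_le_coe (hd.encard_ball_le y R)) ⟨y, mem_ball_self y R⟩
        (disjoint_ballAround_ball hyX) (hloc.1.presOn hA hσ hfinX hneX) hτ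
      have hxi : ∀ j ∈ J, Function.update x i y j = x j := fun j hj =>
        Function.update_of_ne (ne_of_mem_of_not_mem hj hi) _ _
      refine ⟨insert y X, Function.update x i y, σ', hXX.trans (Set.subset_insert y X), ?_, hσ',
        ?_, ?_, ?_⟩
      · rw [Finset.card_insert_of_notMem hi]
        refine (Set.encard_insert_le _ _).trans ?_
        refine (add_le_add hXn le_rfl).trans (le_of_eq ?_)
        push_cast
        ring
      · rw [Finset.coe_insert, Set.injOn_insert (by simpa using hi)]
        refine ⟨hinj.congr fun j hj => (hxi j hj).symm, ?_⟩
        rintro ⟨j, hj, hji⟩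
        rw [hxi j hj, Function.update_self] at hji
        exact hyX' (hji ▸ hmem j hj)
      · intro j hj
        rcases Finset.mem_insert.1 hj with rfl | hj
        · rw [Function.update_self]; exact Set.mem_insert _ _
        · rw [hxi j hj]; exact Set.mem_insert_of_mem _ (hmem j hj)
      · intro j hj
        rcases Finset.mem_insert.1 hj with rfl | hj
        · rw [Function.update_self]
          exact hτi.congr (fun _ _ => Iff.rfl) hagy
        · rw [hxi j hj]
          exact (hreal j hj).congr (fun _ _ => Iff.rfl)
            (hagX.mono (ball_subset_ballAround (hmem j hj) R))
  obtain ⟨X, x, σ, h1, h2, h3, h4, h5, h6⟩ := key Finset.univ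
  exact ⟨X, x, σ, h1, h2, h3, fun i j hij => h4 (by simp) (by simp) hij,
    fun i => h5 i (Finset.mem_univ i), fun i => h6 i (Finset.mem_univ i)⟩

end Realization

/-! ### Construction of Hanf equivalent presentations. -/

section Main

variable {L : FirstOrder.Language.{u, v}} [L.IsRelational] {A B : Str.{u, v, w} L} {k : ℕ}
  {K : Set (Str.{u, v, w} L)} {P : PresentationScheme K k}

/-- Presentations which agree around all rare points, and realize all presentations of frequent
neighborhoods often enough, are Hanf equivalent. -/
theorem hanfEq_expand (hloc : P.IsLocal) (hel : P.IsElementary) (hK : SubstructureClosed K)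
    (hA : A ∈ K) (hB : B ∈ K) {d ν r s t t' : ℕ} (hdA : DegreeBounded d A)
    (hdB : DegreeBounded d B) {ρ : (Fin k → A) → Prop} {σ : (Fin k → B) → Prop}
    (hρ : P.Pres A ρ) (hσ : P.Pres B σ) (hνA : IsExpansionFactor ν A ρ)
    (hνB : IsExpansionFactor ν B σ) (hAB : HanfEq (ν * r) t' A B) (ht' : 0 < t') (hst : s ≤ t')
    {F : PartialEquiv A B} (hF : IsPartialIso (A := expand A ρ) (B := expand B σ) F) {X : Set A}
    (hFs : F.source = ballAround A X (ν * r)) (hFt : F.target = ballAround B (F '' X) (ν * r))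
    (hX : rare (ν * r) s A ⊆ X) (hFrare : F '' rare (ν * r) s A = rare (ν * r) s B)
    (hfreq : ∀ a ∉ rare (ν * r) s A, ∀ ρ' : (Fin k → A) → Prop,
      P.PresOn A (ball A a (ν * r)) ρ' → ∃ x : Fin t → A, Function.Injective x ∧
        (∀ l, x l ∈ X) ∧ ∀ l, SamePresType (ν * r) A ρ' a A ρ (x l)) :
    HanfEq r t (expand A ρ) (expand B σ) := by
  intro C c
  have hFX : ∀ x ∈ X, SameType r (expand A ρ) x (expand B σ) (F x) := fun x hx =>
    (IsPartialIso.samePresType (A := A) (B := B) hF hFs hFt hx).sameType_expand le_rfl hνA hνB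
  have hFinj : InjOn F X := F.injOn.mono (hFs ▸ subset_ballAround X _)
  -- A type forced by a presented frequent neighborhood occurs `t` times in `X`, and `F` carries
  -- these occurrences to `B`.
  have big : ∀ a ∉ rare (ν * r) s A, ∀ ρ' : (Fin k → A) → Prop,
      P.PresOn A (ball A a (ν * r)) ρ' → (∀ x : A, SamePresType (ν * r) A ρ' a A ρ x →
        SameType r C c (expand A ρ) x) →
      EquipollentUpTo t {a : expand A ρ | SameType r C c (expand A ρ) a}
        {b : expand B σ | SameType r C c (expand B σ) b} := by
    intro a ha ρ' hρ' himp
    obtain ⟨x, hx, hxX, hxρ⟩ := hfreq a ha ρ' hρ'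
    refine equipollentUpTo_of_encard_le
      (natCast_le_encard_of_injective hx fun l => himp _ (hxρ l))
      (natCast_le_encard_of_injective (x := fun l => F (x l))
        (fun l l' h => hx (hFinj (hxX l) (hxX l') h)) fun l => ?_)
    exact (himp _ (hxρ l)).trans (hFX _ (hxX l))
  by_cases hSrare : {a : A | SameType r C c (expand A ρ) a} ⊆ rare (ν * r) s A
  swap
  · obtain ⟨a, ha, ha'⟩ := Set.not_subset.1 hSrare
    refine big a ha' ρ (hloc.1.presOn hA hρ (Set.finite_of_encard_le_coe
      (hdA.encard_ball_le a _)) ⟨a, mem_ball_self a _⟩) fun x hx => ?_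
    exact SameType.trans ha (hx.sameType_expand le_rfl hνA hνA)
  by_cases hTrare : {b : B | SameType r C c (expand B σ) b} ⊆ rare (ν * r) s B
  swap
  · obtain ⟨b, hb, hb'⟩ := Set.not_subset.1 hTrare
    obtain ⟨a, hba⟩ := hAB.exists_sameType ht' b
    have ha : a ∉ rare (ν * r) s A := fun h => hb' ((hAB.mem_rare_iff hst hba.symm).1 h)
    have hσb : P.PresOn B (ball B b (ν * r)) σ := hloc.1.presOn hB hσ
      (Set.finite_of_encard_le_coe (hdB.encard_ball_le b _)) ⟨b, mem_ball_self b _⟩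
    -- The presented neighborhood of `b` is copied to a frequent neighborhood in `A`; the copy need
    -- not be part of `ρ`, which is why `hfreq` ranges over all `ρ'`.
    obtain ⟨ρ', hρ', hρ'σ⟩ := LocalIso.presOn_transfer hel hK hA hba hσb
    refine big a ha ρ' hρ' fun x hx => ?_
    have hbx : SamePresType (ν * r) B σ b A ρ x := LocalIso.trans hρ'σ hx
    exact SameType.trans hb (hbx.sameType_expand le_rfl hνB hνA)
  · have himg : {b : B | SameType r C c (expand B σ) b} =
        F '' {a : A | SameType r C c (expand A ρ) a} := by
      apply Set.Subset.antisymm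
      · intro b hb
        obtain ⟨a, ha, rfl⟩ := hFrare.ge (hTrare hb)
        exact ⟨a, SameType.trans hb (hFX a (hX ha)).symm, rfl⟩
      · rintro _ ⟨a, ha, rfl⟩
        exact SameType.trans ha (hFX a (hX (hSrare ha)))
    refine Or.inl (Eq.symm ?_)
    change Cardinal.mk {b : B | SameType r C c (expand B σ) b} = _
    rw [himg]
    exact Cardinal.mk_image_eq_of_injOn _ _ (hFinj.mono (hSrare.trans hX))

/-- Hanf equivalent structures of bounded degree have Hanf equivalent presentations. -/
theorem exists_hanfEq_expand [Finite (Σ n, L.Relations n)] (hne : ∀ A ∈ K, Nonempty A)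
    (hK : SubstructureClosed K) (hloc : P.IsLocal) (hel : P.IsElementary) {ν : ℕ}
    (hν : ∀ A ∈ K, FiniteDegree A → ∀ ρ : (Fin k → A) → Prop, P.Pres A ρ →
      IsExpansionFactor ν A ρ) (d r t : ℕ) :
    ∃ r' t' : ℕ, ∀ A ∈ K, ∀ B ∈ K, DegreeBounded d A → DegreeBounded d B → HanfEq r' t' A B →
      ∃ (ρ : (Fin k → A) → Prop) (σ : (Fin k → B) → Prop), P.Pres A ρ ∧ P.Pres B σ ∧
        HanfEq r t (expand A ρ) (expand B σ) := by
  classical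
  have hfinRel := finite_relations_withRel (L := L) k
  obtain ⟨N, hN⟩ := exists_encard_rare_le.{u, v, w} (L := L) d (ν * r)
  obtain ⟨T, hT, code, hcode⟩ :=
    exists_finite_code.{u, v, w} (L := withRel L k) ((d + 1) ^ (ν * r))
  -- The bracket bounds `X`: rare points, the base point `a₀`, and `t` realizations per code.
  -- Multiplied by a ball size, it is the room that `exists_pres_realizing` asks for.
  let g : ℕ → ℕ := fun s =>
    s + (N * s + 1 + Nat.card T * t) * (d + 1) ^ (2 * (ν * r) + 1) + 1
  obtain ⟨M, hM⟩ := exists_gap.{u, v, w} (L := L) d (ν * r) g fun n => by simp only [g]; lia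
  obtain ⟨r', t', hr', hgame⟩ :=
    exists_partialIso_of_hanfEq.{u, v, w} (L := L) d (N * M + 1 + Nat.card T * t) (ν * r)
  -- `s` will depend on `A`, but `s ≤ M`; threshold `M` therefore makes rarity mean the same in `A`
  -- and `B`.
  refine ⟨r', max t' M, fun A hA B hB hdA hdB hAB => ?_⟩
  obtain ⟨a₀⟩ := hne A hA
  obtain ⟨s, hs0, hsM, hs⟩ := hM A hdA
  have hsM' : s ≤ M := le_trans (by simp only [g]; lia) hsM
  have hNs : N * s ≤ N * M := Nat.mul_le_mul_left N hsM'
  have hABR : HanfEq (ν * r) M A B := (hAB.mono_radius hr').mono_threshold (le_max_right _ _)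
  have hABg := hAB.mono_threshold (le_max_left t' M)
  -- the presentations of frequent neighborhoods, up to isomorphism
  let I : Set T := {τ | ∃ (a : A) (ρ : (Fin k → A) → Prop), a ∉ rare (ν * r) s A ∧
    P.PresOn A (ball A a (ν * r)) ρ ∧ code (expand A ρ) (ball A a (ν * r)) a = τ}
  choose a ρ hrare hpres hcodeI using fun τ : I => τ.2
  have : Fintype I := Fintype.ofFinite I
  have hcard : Fintype.card (I × Fin t) ≤ Nat.card T * t := by
    rw [Fintype.card_prod, Fintype.card_fin, ← Nat.card_eq_fintype_card]
    exact Nat.mul_le_mul_right t (Nat.card_le_card_of_injective _ Subtype.val_injective)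
  have hX₀ : (insert a₀ (rare (ν * r) s A)).encard ≤ ((N * s + 1 : ℕ) : ℕ∞) := by
    refine (Set.encard_insert_le _ _).trans ((add_le_add (hN A hdA s) le_rfl).trans ?_)
    push_cast
    exact le_rfl
  obtain ⟨X, x, ρA, hXX, hXn, hρA, hxinj, hxX, hxρ⟩ := exists_pres_realizing hloc hel hK hA hdA
    (Set.insert_nonempty a₀ _) hX₀ (ι := I × Fin t) (fun i => a i.1) (fun i => ρ i.1)
    (fun i => hpres i.1) fun i => by
      refine lt_of_lt_of_le ?_ (hs _ (hrare i.1))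
      have h1 := Nat.mul_le_mul_right ((d + 1) ^ (2 * (ν * r) + 1))
        (Nat.add_le_add_left hcard (N * s + 1))
      have h2 : (N * s + 1 + Fintype.card (I × Fin t)) * (d + 1) ^ (2 * (ν * r) + 1) < g s := by
        simp only [g]; lia
      exact_mod_cast h2
  have hXn' : X.encard ≤ ((N * M + 1 + Nat.card T * t : ℕ) : ℕ∞) := by
    refine hXn.trans ?_
    have : N * s + 1 + Fintype.card (I × Fin t) ≤ N * M + 1 + Nat.card T * t := by lia
    exact_mod_cast this
  have hrareX : rare (ν * r) s A ⊆ X := (Set.subset_insert _ _).trans hXX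
  obtain ⟨F, hF, hFs, hFt⟩ := hgame A B (hne A hA) hdA hABg X hXn'
  obtain ⟨G, hG, hGs, hGt⟩ := hgame B A (hne B hB) hdB hABg.symm (rare (ν * r) s B) (by
    refine (hN B hdB s).trans ?_
    have : N * s ≤ N * M + 1 + Nat.card T * t := by lia
    exact_mod_cast this)
  have hFrare := hABR.image_rare hsM' (hN A hdA s) hF hFs hFt hrareX hG hGs hGt
  have hXne : X.Nonempty := (Set.insert_nonempty a₀ _).mono hXX
  have hsne : F.source.Nonempty := hFs ▸ hXne.mono (subset_ballAround X _)
  have htne : F.target.Nonempty := hsne.elim fun y hy => ⟨F y, F.map_source hy⟩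
  have hsfin : F.source.Finite :=
    hFs ▸ Set.finite_of_encard_le_coe (hdA.encard_ballAround_le hXn' _)
  have htfin : F.target.Finite := F.image_source_eq_target ▸ hsfin.image F
  have hFρ := hF.expand_transferRel ρA
  -- The transported relation is meaningful only on `F.target`, so a presentation of `B` agreeing
  -- with it there is chosen.
  obtain ⟨σB, hσB, hag⟩ := hloc.exists_extension hel hK hB htfin htne
    (hel.presOn_of_isPartialIso hK hB hFρ htne (hloc.1.presOn hA hρA hsfin hsne))
  have hFσ : IsPartialIso (A := expand A ρA) (B := expand B σB) F :=
    IsPartialIso.expand_congr (A := A) (B := B) hFρ (fun _ _ => Iff.rfl) hag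
  refine ⟨ρA, σB, hρA, hσB, hanfEq_expand hloc hel hK hA hB hdA hdB hρA hσB
    (hν A hA hdA.finiteDegree ρA hρA) (hν B hB hdB.finiteDegree σB hσB) hABR (hs0.trans_le hsM')
    hsM' hFσ hFs hFt hrareX hFrare fun b hb ρ' hρ' => ?_⟩
  let τ : I := ⟨code (expand A ρ') (ball A b (ν * r)) b, b, ρ', hb, hρ', rfl⟩
  refine ⟨fun l => x (τ, l), fun l l' h => (Prod.mk.inj (hxinj h)).2, fun l => hxX _,
    fun l => ?_⟩
  have hτ : SamePresType (ν * r) A ρ' b A (ρ τ) (a τ) :=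
    hcode (expand A ρ') (expand A (ρ τ)) _ _ _ _ (hdA.encard_ball_le b _)
      (hdA.encard_ball_le (a τ) _) (mem_ball_self b _) (mem_ball_self (a τ) _) (hcodeI τ).symm
  exact LocalIso.trans hτ (hxρ (τ, l))

end Main

end HanfLocality

theorem mainTheorem2 {L : FirstOrder.Language.{u, v}} [L.IsRelational]
    [Finite (Σ n, L.Relations n)]
    (K : Set (HanfLocality.Str.{u, v, w} L)) (hne : ∀ A ∈ K, Nonempty A)
    (hK : HanfLocality.SubstructureClosed K)
    (k : ℕ) (P : HanfLocality.PresentationScheme K k)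
    (hloc : P.IsLocal) (hnb : P.IsNeighborhoodBounded) (hel : P.IsElementary)
    (J : Set (HanfLocality.Str.{u, v, w} L)) (hJ : P.InvariantElementary J) :
    ∀ d : ℕ, ∃ r t : ℕ, HanfLocality.HanfThresholdLocal r t J
      (K ∩ {A | HanfLocality.DegreeBounded d A}) := by
  intro d
  obtain ⟨ν, hν⟩ := hnb
  obtain ⟨θ, hinv, hθ⟩ := hJ
  obtain ⟨r, t, hanf⟩ :=
    HanfLocality.exists_realize_sentence_iff_of_hanfEq.{u, v, w} (L := HanfLocality.withRel L k)
      ((d + 1) ^ ν) θ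
  obtain ⟨r', t', h⟩ := HanfLocality.exists_hanfEq_expand hne hK hloc hel hν d r t
  -- Invariance lets any single presentation test membership in `J`.
  have mem_iff : ∀ A ∈ K, ∀ ρ : (Fin k → A) → Prop, P.Pres A ρ →
      (A ∈ J ↔ HanfLocality.expand A ρ ⊨ θ) :=
    fun A hA ρ hρ => by
      rw [hθ A hA]
      exact ⟨fun hex => (hinv A hA).1 hex ρ hρ, fun hρθ => ⟨ρ, hρ, hρθ⟩⟩
  refine ⟨r', t', fun A hA B hB hAB => ?_⟩
  obtain ⟨ρ, σ, hρ, hσ, hρσ⟩ := h A hA.1 B hB.1 hA.2 hB.2 hAB.hanfEq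
  rw [mem_iff A hA.1 ρ hρ, mem_iff B hB.1 σ hσ]
  have hA' : HanfLocality.DegreeBounded d A := hA.2
  have hB' : HanfLocality.DegreeBounded d B := hB.2
  exact hanf (HanfLocality.expand A ρ) (HanfLocality.expand B σ) (hne A hA.1)
    (HanfLocality.IsExpansionFactor.degreeBounded (hν A hA.1 hA'.finiteDegree ρ hρ) hA')
    (HanfLocality.IsExpansionFactor.degreeBounded (hν B hB.1 hB'.finiteDegree σ hσ) hB') hρσ
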